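/- Let $\mathbb D=\mathbb R$ or $\mathbb D=\mathbb T=\mathbb R/2\pi\mathbb Z$. Let $V\in C^\infty(\mathbb D)$ with $Z=\int_{\mathbb D}e^{-V}<\infty$, let $\mu=e^{-V}/Z$, and let $f\in C^\infty(\mathbb D)$ be $\mu$-integrable and not $\mu$-almost everywhere constant. Put $I=\int_{\mathbb D} f\,d\mu$. For $U:\mathbb D\to\mathbb R$ write $Z[U]=\int_{\mathbb D}e^{-V-U}$ and $\mu_U=e^{-V-U}/Z[U]$. Let $\mathfrak U_0$ be the set of biasing potentials $U\in C^\infty(\mathbb D)$ such that: (i) $e^{-V-U}$ is Lebesgue integrable on $\mathbb D$; (ii) $\mu_U$ satisfies a Poincaré inequality: there is $R>0$ with $\|\varphi\|_{L^2(\mu_U)}^2\le \frac1R\|\varphi'\|_{L^2(\mu_U)}^2$ for all $\varphi\in H^1(\mu_U)\cap L^2_0(\mu_U)$, where $L^2_0(\mu_U)$ is the space of $\mu_U$-mean-zero functions of $L^2(\mu_U)$ and $H^1(\mu_U)$ is the space of functions of $L^2(\mu_U)$ with weak derivative in $L^2(\mu_U)$; (iii) $(f-I)e^U\in L^2(\mu_U)$;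 (iv) for every $x_0\in\mathbb D$ there is a unique strong solution of $dX_t=-(V+U)'(X_t)\,dt+\sqrt2\,dW_t$ with $X_0=x_0$. The asymptotic variance associated with $U$ is $$\sigma^2_f[U]=\frac{2Z[U]^2}{Z^2}\int_{\mathbb D}|\phi_U'|^2\,d\mu_U,$$ where $\phi_U\in H^1(\mu_U)\cap L^2_0(\mu_U)$ is the distributional solution of $-\mathcal L_U\phi_U=(f-I)e^U$, with $\mathcal L_U=-(V+U)'\,\partial_x+\partial_x^2$. Let $F(x)=\int_0^x(f-I)e^{-V}$, let $A^*_{\mathbb R}=-\int_{-\infty}^0(f-I)e^{-V}$ and $A^*_{\mathbb T}=\sup\{A\in\mathbb R:\int_{\mathbb T}\operatorname{sgn}(F-A)\ge0\}$ (a median of $F$), and set $$\sigma^*_f=\frac{2}{Z^2}\left(\int_{\mathbb D}|F-A^*_{\mathbb D}|\,dx\right)^2 .$$ Suppose that $0\in\mathfrak U_0$. Then $C_c^\infty(\mathbb D)\subset\mathfrak U_0$; for every $U\in\mathfrak U_0$ the solution $\phi_U$ exists and is unique (up to null sets), so that $\sigma^2_f[U]$ is well defined; $F-A^*_{\mathbb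 D}$ is integrable on $\mathbb D$; and $$\inf_{U\in\mathfrak U_0}\sigma^2_f[U]=\sigma^*_f,\qquad \inf_{U\in C_c^\infty(\mathbb D)}\sigma^2_f[U]=\sigma^*_f .$$ -/

import Mathlib

open MeasureTheory ProbabilityTheory
open scoped ContDiff NNReal

namespace BiasedLangevin

noncomputable section

/-- The two one-dimensional state spaces `𝔻`: the real line, and the torus `𝕋 = ℝ / 2πℤ`.
A function on the torus is represented by a `2π`-periodic function on `ℝ`, or, when only its class
modulo null sets matters, by its values on the fundamental domain `(-π, π]`. -/
inductive Dom
  | line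
  | torus

/-- Lebesgue measure on `𝔻` (for the torus: carried by the fundamental domain `(-π, π]`). -/
def Dom.vol : Dom → Measure ℝ
  | .line => volume
  | .torus => volume.restrict (Set.Ioc (-Real.pi) Real.pi)

/-- `u ∈ C^∞(𝔻)`. -/
def Dom.Smooth : Dom → (ℝ → ℝ) → Prop
  | .line, u => ContDiff ℝ ∞ u
  | .torus, u => ContDiff ℝ ∞ u ∧ Function.Periodic u (2 * Real.pi)

/-- `u ∈ C_c^∞(𝔻)`; the torus being compact, `C_c^∞(𝕋) = C^∞(𝕋)`. -/
def Dom.SmoothCompact : Dom → (ℝ → ℝ) → Prop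
  | .line, u => ContDiff ℝ ∞ u ∧ HasCompactSupport u
  | .torus, u => ContDiff ℝ ∞ u ∧ Function.Periodic u (2 * Real.pi)

/-- The normalization constant `∫_𝔻 e^{-W}` of a potential `W`. It is `Z` for `W = V`, and `Z[U]`
for `W = V + U`. -/
def partition (D : Dom) (W : ℝ → ℝ) : ℝ := ∫ x, Real.exp (-W x) ∂D.vol

/-- The probability measure on `𝔻` with density `e^{-W} / ∫_𝔻 e^{-W}`. It is `μ` for `W = V`, and
`μ_U` for `W = V + U`. -/
def gibbs (D : Dom) (W : ℝ → ℝ) : Measure ℝ :=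
  D.vol.withDensity fun x => ENNReal.ofReal (Real.exp (-W x) / partition D W)

/-- `I = ∫ f dμ`. -/
def mean (D : Dom) (V f : ℝ → ℝ) : ℝ := ∫ x, f x ∂(gibbs D V)

/-! ### Sobolev space, Poincaré inequality -/

/-- `φ'` is the weak (distributional) derivative of `φ` on `𝔻`. -/
def IsWeakDeriv (D : Dom) (φ φ' : ℝ → ℝ) : Prop :=
  ∀ η : ℝ → ℝ, D.SmoothCompact η → ∫ x, φ x * deriv η x ∂D.vol = -∫ x, φ' x * η x ∂D.vol

/-- `φ ∈ H¹(ν) ∩ L²₀(ν)`, with weak derivative `φ'`. -/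
structure MemH1Zero (D : Dom) (ν : Measure ℝ) (φ φ' : ℝ → ℝ) : Prop where
  memLp : MemLp φ 2 ν
  mean_zero : ∫ x, φ x ∂ν = 0
  memLp_deriv : MemLp φ' 2 ν
  weakDeriv : IsWeakDeriv D φ φ'

/-- `ν` satisfies a Poincaré inequality. -/
def Poincare (D : Dom) (ν : Measure ℝ) : Prop :=
  ∃ R : ℝ, 0 < R ∧ ∀ φ φ' : ℝ → ℝ, MemH1Zero D ν φ φ' →
    ∫ x, φ x ^ 2 ∂ν ≤ 1 / R * ∫ x, φ' x ^ 2 ∂ν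

/-! ### Strong solutions of the stochastic differential equation -/

/-- `X` is a strong solution of `dX_t = b(X_t) dt + √2 dB_t`, `X_0 = x₀`, on the given probability
space and for the given Brownian motion `B`. Adaptedness is to the filtration generated by `B` and
completed by the null sets. -/
structure IsStrongSolution {Ω : Type} [MeasurableSpace Ω] (P : Measure Ω) (B : ℝ≥0 → Ω → ℝ)
    (b : ℝ → ℝ) (x₀ : ℝ) (X : ℝ≥0 → Ω → ℝ) : Prop where
  adapted : ∀ t : ℝ≥0,
    AEStronglyMeasurable[⨆ s ≤ t, MeasurableSpace.comap (B s) inferInstance] (X t) P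
  continuous : ∀ᵐ w ∂P, Continuous fun t => X t w
  equation : ∀ᵐ w ∂P, ∀ t : ℝ≥0,
    X t w = x₀ + (∫ s in (0 : ℝ)..t, b (X s.toNNReal w)) + √2 * B t w

/-- From every deterministic initial condition, on every probability space with a Brownian motion,
the equation `dX_t = b(X_t) dt + √2 dB_t` has a strong solution, unique up to
indistinguishability. When `b` is periodic this is the well-posedness of the equation on the
torus, written for the continuous lift of the solution to `ℝ`. -/
def StronglyWellPosed (b : ℝ → ℝ) : Prop :=
  ∀ (x₀ : ℝ) (Ω : Type) [MeasurableSpace Ω] (P : Measure Ω) [IsProbabilityMeasure P]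
    (B : ℝ≥0 → Ω → ℝ), (∀ t, Measurable (B t)) → IsBrownianReal B P →
    ∃ X : ℝ≥0 → Ω → ℝ, IsStrongSolution P B b x₀ X ∧
      ∀ Y : ℝ≥0 → Ω → ℝ, IsStrongSolution P B b x₀ Y → ∀ᵐ w ∂P, ∀ t, Y t w = X t w

/-! ### Biasing potentials and asymptotic variance -/

/-- The set `𝔘₀(V, f)` of nice biasing potentials. -/
structure MemU0 (D : Dom) (V f U : ℝ → ℝ) : Prop where
  smooth : D.Smooth U
  integrable : Integrable (fun x => Real.exp (-(V + U) x)) D.vol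
  poincare : Poincare D (gibbs D (V + U))
  memLp : MemLp (fun x => (f x - mean D V f) * Real.exp (U x)) 2 (gibbs D (V + U))
  wellPosed : StronglyWellPosed fun x => -deriv (V + U) x

/-- The generator `𝓛 η = -W' η' + η''` of the overdamped Langevin dynamics with potential `W`. -/
def generator (W η : ℝ → ℝ) (x : ℝ) : ℝ := -deriv W x * deriv η x + deriv (deriv η) x

/-- `φ ∈ H¹(μ_U) ∩ L²₀(μ_U)`, with weak derivative `φ'`, is a distributional solution of the Poisson
equation `-𝓛_U φ = (f - I) e^U`. The generator `𝓛_U`, which is symmetric with respect to `μ_U`, is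
moved to the test functions. -/
structure IsPoissonSolution (D : Dom) (V f U φ φ' : ℝ → ℝ) : Prop where
  memH1Zero : MemH1Zero D (gibbs D (V + U)) φ φ'
  equation : ∀ η : ℝ → ℝ, D.SmoothCompact η →
    ∫ x, φ x * -generator (V + U) η x ∂(gibbs D (V + U)) =
      ∫ x, (f x - mean D V f) * Real.exp (U x) * η x ∂(gibbs D (V + U))

open Classical in
/-- The asymptotic variance `σ²_f[U] = (2 Z[U]² / Z²) ∫ |φ_U'|² dμ_U`, where `φ_U` is the solution of
the Poisson equation (value `0` if there is no solution). -/
def asymVar (D : Dom) (V f U : ℝ → ℝ) : ℝ :=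
  if h : ∃ p : (ℝ → ℝ) × (ℝ → ℝ), IsPoissonSolution D V f U p.1 p.2 then
    2 * partition D (V + U) ^ 2 / partition D V ^ 2 *
      ∫ x, |h.choose.2 x| ^ 2 ∂(gibbs D (V + U))
  else 0

/-! ### The optimal value -/

/-- `F(x) = ∫₀ˣ (f - I) e^{-V}`. -/
def primF (D : Dom) (V f : ℝ → ℝ) (x : ℝ) : ℝ :=
  ∫ ξ in (0 : ℝ)..x, (f ξ - mean D V f) * Real.exp (-V ξ)

/-- The constant `A*_𝔻`: `-∫_{-∞}^0 (f - I) e^{-V}` on the line, and the median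
`sup {A | ∫_𝕋 sgn(F - A) ≥ 0}` of `F` on the torus. -/
def Astar (D : Dom) (V f : ℝ → ℝ) : ℝ :=
  match D with
  | .line => -∫ x in Set.Iic (0 : ℝ), (f x - mean .line V f) * Real.exp (-V x)
  | .torus => sSup {A : ℝ | 0 ≤ ∫ x, Real.sign (primF .torus V f x - A) ∂Dom.torus.vol}

/-- `σ*_f = (2 / Z²) (∫_𝔻 |F - A*_𝔻|)²`. -/
def sigmaStar (D : Dom) (V f : ℝ → ℝ) : ℝ :=
  2 / partition D V ^ 2 * (∫ x, |primF D V f x - Astar D V f| ∂D.vol) ^ 2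

end

end BiasedLangevin

/-!
Integrating the Poisson equation once gives `φ_U' e^{-(V + U)} = -(F - A_U)` for a constant `A_U`,
so that `σ²_f[U] = (2 / Z²) ∫ e^{-(V + U)} ∫ (F - A_U)² e^{V + U}`. By Cauchy–Schwarz this is at
least `(2 / Z²) (∫ |F - A_U|)²`. On the line, decay at infinity forces `A_U = A*`; on the torus, the
median `A*` minimises `A ↦ ∫ |F - A|`. Equality would require `e^{-(V + U)}` to be proportional to
`|F - A*|`, which vanishes somewhere; regularizing this density, and gluing it to `e^{-V}` outside a
large ball, gives smooth compactly supported biases with variance arbitrarily close to the bound.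

A bias in `C_c^∞` perturbs `V` boundedly, which preserves the Poincaré inequality and
`(f - I) e^U ∈ L²`. The noise being additive, the stochastic equation is solved path by path, and
changing the drift on a compact set does not affect its well-posedness.
-/

namespace BiasedLangevin

open Set Filter Topology

section DrivenPaths

variable {E : Type*} [NormedAddCommGroup E] [NormedSpace ℝ E]

/-- On `[s, t]`, the continuous path `x` solves the integral equation `dx = b(x) du + dp` with drift
`b` and forcing path `p`. For `p = √2 B(ω)` this is the stochastic equation, read path by path. -/
structure IsDriven (b : E → E) (p x : ℝ → E) (s t : ℝ) : Prop where
  continuous : Continuous x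
  eq : ∀ r ∈ Icc s t, x r = x s + (∫ u in s..r, b (x u)) + (p r - p s)

/-- The path `x` solves `dx = b(x) du + dp` on `[s, ∞)` and starts from `x₀` at time `s`. -/
structure IsGlobalDriven (b : E → E) (p x : ℝ → E) (s : ℝ) (x₀ : E) : Prop where
  isDriven : ∀ t, IsDriven b p x s t
  start : x s = x₀

/-- A priori bound: every solution of `dx = b(x) du + dp`, `x 0 = x₀`, on an initial segment of
`[0, T]` stays in the ball of radius `C`. -/
def IsAprioriBound (b : E → E) (p : ℝ → E) (x₀ : E) (T C : ℝ) : Prop :=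
  ∀ t ∈ Icc 0 T, ∀ x, IsDriven b p x 0 t → x 0 = x₀ → ‖x t‖ ≤ C

namespace IsDriven

variable {b g : E → E} {p x y : ℝ → E} {s t s' t' : ℝ}

lemma sub_eq (hb : Continuous b) (hx : IsDriven b p x s t) {r r' : ℝ} (hr : r ∈ Icc s t)
    (hr' : r' ∈ Icc s t) : x r' - x r = (∫ u in r..r', b (x u)) + (p r' - p r) := by
  have hc : Continuous fun u => b (x u) := hb.comp hx.continuous
  rw [hx.eq r hr, hx.eq r' hr', ← intervalIntegral.integral_interval_sub_left
    (hc.intervalIntegrable (μ := volume) s r') (hc.intervalIntegrable s r)]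
  abel

lemma mono (hb : Continuous b) (hx : IsDriven b p x s t) (hs : s ≤ s') (ht : t' ≤ t) :
    IsDriven b p x s' t' where
  continuous := hx.continuous
  eq r hr := by
    rw [add_assoc, ← hx.sub_eq hb ⟨hs, hr.1.trans (hr.2.trans ht)⟩ ⟨hs.trans hr.1, hr.2.trans ht⟩]
    abel

lemma congr_drift (hx : IsDriven b p x s t) (h : ∀ u ∈ Icc s t, b (x u) = g (x u)) :
    IsDriven g p x s t where
  continuous := hx.continuous
  eq r hr := by
    rw [hx.eq r hr, intervalIntegral.integral_congr fun u hu => h u ?_]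
    rw [uIcc_of_le hr.1] at hu
    exact ⟨hu.1, hu.2.trans hr.2⟩

lemma neg (hx : IsDriven b p x s t) :
    IsDriven (fun z => -b (-z)) (fun u => -p u) (fun u => -x u) s t where
  continuous := hx.continuous.neg
  eq r hr := by
    rw [hx.eq r hr]
    simp only [neg_neg, intervalIntegral.integral_neg]
    abel

lemma comp_sub_right (hx : IsDriven b p x s t) (q : ℝ) :
    IsDriven b (fun u => p (u - q)) (fun u => x (u - q)) (s + q) (t + q) where
  continuous := hx.continuous.comp (continuous_id.sub continuous_const)
  eq r hr := by
    rw [intervalIntegral.integral_comp_sub_right (fun u => b (x u)), add_sub_cancel_right]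
    exact hx.eq (r - q) ⟨by linarith [hr.1], by linarith [hr.2]⟩

lemma congr_forcing {q : ℝ → E} (hx : IsDriven b p x s t)
    (h : ∀ r ∈ Icc s t, q r - q s = p r - p s) : IsDriven b q x s t where
  continuous := hx.continuous
  eq r hr := by rw [h r hr, hx.eq r hr]

lemma congr_path (hx : IsDriven b p x s t) (hy : Continuous y) (h : EqOn y x (Icc s t)) :
    IsDriven b p y s t where
  continuous := hy
  eq r hr := by
    rw [h hr, h ⟨le_rfl, hr.1.trans hr.2⟩, hx.eq r hr,
      intervalIntegral.integral_congr fun u hu => ?_]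
    rw [uIcc_of_le hr.1] at hu
    rw [h ⟨hu.1, hu.2.trans hr.2⟩]

lemma eqOn_of_eq_left [CompleteSpace E] (hb : LocallyLipschitz b) (hx : IsDriven b p x s t)
    (hy : IsDriven b p y s t) (h : x s = y s) : EqOn x y (Icc s t) := by
  obtain ⟨K, hK⟩ := (hb.locallyLipschitzOn (s := x '' Icc s t ∪ y '' Icc s t)
    ).exists_lipschitzOnWith_of_compact
      ((isCompact_Icc.image hx.continuous).union (isCompact_Icc.image hy.continuous))
  have hcx : Continuous fun u => b (x u) := hb.continuous.comp hx.continuous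
  have hcy : Continuous fun u => b (y u) := hb.continuous.comp hy.continuous
  have sub_eq_integral : ∀ r ∈ Icc s t, x r - y r = ∫ u in s..r, (b (x u) - b (y u)) := by
    intro r hr
    rw [intervalIntegral.integral_sub (hcx.intervalIntegrable _ _) (hcy.intervalIntegrable _ _),
      hx.eq r hr, hy.eq r hr, h]
    abel
  have hderiv (r : ℝ) :
      HasDerivAt (fun r => ∫ u in s..r, (b (x u) - b (y u))) (b (x r) - b (y r)) r :=
    ((hcx.sub hcy).integral_hasStrictDerivAt s r).hasDerivAt
  have integral_eq_zero := eq_zero_of_abs_deriv_le_mul_abs_self_of_eq_zero_right (K := K) (b := t)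
    (fun r _ => (hderiv r).continuousAt.continuousWithinAt)
    (fun r _ => (hderiv r).hasDerivWithinAt) intervalIntegral.integral_same fun r hr => by
      have hr' := Ico_subset_Icc_self hr
      rw [← sub_eq_integral r hr', ← dist_eq_norm, ← dist_eq_norm]
      exact hK.dist_le_mul _ (.inl (mem_image_of_mem x hr')) _ (.inr (mem_image_of_mem y hr'))
  exact fun r hr => sub_eq_zero.1 ((sub_eq_integral r hr).trans (integral_eq_zero r hr))

lemma le_of_le_left {b p x y : ℝ → ℝ} (hb : LocallyLipschitz b) (hx : IsDriven b p x s t)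
    (hy : IsDriven b p y s t) (h : x s ≤ y s) : ∀ r ∈ Icc s t, x r ≤ y r := by
  intro r hr
  by_contra! hlt
  obtain ⟨q, hq, hq0⟩ := intermediate_value_Icc hr.1
    (hx.continuous.sub hy.continuous).continuousOn
    (show (0 : ℝ) ∈ Icc _ _ from ⟨sub_nonpos.2 h, sub_nonneg.2 hlt.le⟩)
  exact hlt.ne' (eqOn_of_eq_left hb (hx.mono hb.continuous hq.1 hr.2)
    (hy.mono hb.continuous hq.1 hr.2) (sub_eq_zero.1 hq0) ⟨hq.2, le_rfl⟩)

end IsDriven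

lemma IsGlobalDriven.neg {b : E → E} {p x : ℝ → E} {s : ℝ} {x₀ : E}
    (hx : IsGlobalDriven b p x s x₀) :
    IsGlobalDriven (fun z => -b (-z)) (fun u => -p u) (fun u => -x u) s (-x₀) where
  isDriven t := (hx.isDriven t).neg
  start := by rw [hx.start]

lemma exists_isDriven_of_lipschitzWith_of_bounded [CompleteSpace E] {b : E → E} {p : ℝ → E}
    {K : ℝ≥0} {C : ℝ} (hb : LipschitzWith K b) (hC : ∀ z, ‖b z‖ ≤ C) (hp : Continuous p) (x₀ : E)
    {T : ℝ} (hT : 0 ≤ T) : ∃ x, IsDriven b p x 0 T ∧ x 0 = x₀ := by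
  lift C to ℝ≥0 using (norm_nonneg _).trans (hC 0)
  lift T to ℝ≥0 using hT
  -- `x` solves the driven equation iff `x - p` solves the ordinary equation `z' = b(z + p)`.
  have hP : IsPicardLindelof (fun u z => b (z + p u)) (tmin := 0) (tmax := (T : ℝ))
      ⟨0, by simp⟩ (x₀ - p 0) (C * T) 0 C K := by
    refine ⟨fun u _ => ?_, fun z _ => ?_, fun u _ z _ => hC _, by simp⟩
    · refine (LipschitzWith.of_dist_le_mul fun z z' => ?_).lipschitzOnWith
      simpa using hb.dist_le_mul (z + p u) (z' + p u)
    · exact (hb.continuous.comp (by fun_prop)).continuousOn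
  obtain ⟨α, hα0, hα⟩ := hP.exists_eq_forall_mem_Icc_hasDerivWithinAt₀
  set β : ℝ → E := IccExtend T.2 ((Icc (0 : ℝ) T).domRestrict α)
  have hβc : Continuous β := (continuousOn_iff_continuous_domRestrict.1
    fun u hu => (hα u hu).continuousWithinAt).Icc_extend'
  have hβα : EqOn β α (Icc 0 T) := fun u hu => IccExtend_of_mem _ _ hu
  have hβ0 : β 0 = x₀ - p 0 := (hβα ⟨le_rfl, T.2⟩).trans hα0
  refine ⟨fun u => β u + p u, ⟨by fun_prop, fun r hr => ?_⟩, by simp [hβ0]⟩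
  have hc : Continuous fun u => b (β u + p u) := hb.continuous.comp (by fun_prop)
  have hβ' : ∀ u ∈ Ioo 0 r, HasDerivAt β (b (β u + p u)) u := fun u hu => by
    have hu' : u ∈ Ioo (0 : ℝ) T := ⟨hu.1, hu.2.trans_le hr.2⟩
    have hnhds : Icc (0 : ℝ) T ∈ 𝓝 u := Icc_mem_nhds hu'.1 hu'.2
    rw [hβα (Ioo_subset_Icc_self hu')]
    exact ((hα u (Ioo_subset_Icc_self hu')).hasDerivAt hnhds).congr_of_eventuallyEq
      (eventually_of_mem hnhds hβα)
  rw [intervalIntegral.integral_eq_sub_of_hasDerivAt_of_le hr.1 hβc.continuousOn hβ'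
    (hc.intervalIntegrable _ _)]
  abel

end DrivenPaths

section Visits

variable {x : ℝ → ℝ} {s t a c : ℝ}

lemma exists_first_visit (hx : Continuous x) (hst : s ≤ t) (hs : x s ≤ a) (ht : a ≤ x t) :
    ∃ r ∈ Icc s t, x r = a ∧ ∀ u ∈ Icc s r, x u ≤ a := by
  obtain ⟨r, ⟨hra, hr⟩, hleast⟩ := (isCompact_Icc.inter_left (isClosed_singleton.preimage hx) :
    IsCompact (x ⁻¹' {a} ∩ Icc s t)).exists_isLeast (by
      obtain ⟨u, hu, hua⟩ := intermediate_value_Icc hst hx.continuousOn ⟨hs, ht⟩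
      exact ⟨u, hua, hu⟩)
  refine ⟨r, hr, hra, fun u hu => ?_⟩
  by_contra! hlt
  obtain ⟨v, hv, hva⟩ := intermediate_value_Icc hu.1 hx.continuousOn ⟨hs, hlt.le⟩
  have hru : u = r := hu.2.antisymm ((hleast ⟨hva, hv.1, hv.2.trans (hu.2.trans hr.2)⟩).trans hv.2)
  exact hlt.ne' (hru ▸ hra)

lemma exists_last_visit (hx : Continuous x) (hst : s ≤ t) (hs : x s ≤ a) (ht : a ≤ x t) :
    ∃ q ∈ Icc s t, x q = a ∧ ∀ u ∈ Icc q t, a ≤ x u := by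
  obtain ⟨r, hr, hra, hle⟩ := exists_first_visit (x := fun u => -x (-u)) (s := -t) (t := -s)
    (a := -a) (hx.comp continuous_neg).neg (neg_le_neg hst) (by simpa using ht) (by simpa using hs)
  refine ⟨-r, ⟨by linarith [hr.2], by linarith [hr.1]⟩, neg_injective hra, fun u hu => ?_⟩
  simpa using hle (-u) ⟨neg_le_neg hu.2, by linarith [hu.1]⟩

lemma exists_upcrossing (hx : Continuous x) (hst : s ≤ t) (hs : x s ≤ a) (hac : a ≤ c)
    (ht : c ≤ x t) : ∃ q r, s ≤ q ∧ q ≤ r ∧ r ≤ t ∧ x q = a ∧ x r = c ∧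
      (∀ u ∈ Icc q t, a ≤ x u) ∧ ∀ u ∈ Icc q r, x u ≤ c := by
  obtain ⟨q, hq, hqa, hge⟩ := exists_last_visit hx hst hs (hac.trans ht)
  obtain ⟨r, hr, hrc, hle⟩ := exists_first_visit hx hq.2 (hqa.trans_le hac) ht
  exact ⟨q, r, hq.1, hr.1, hr.2, hqa, hrc, hge, hle⟩

end Visits

section GlobalExistence

variable {b p : ℝ → ℝ} {x₀ : ℝ}

lemma IsAprioriBound.abs_start_le {T C : ℝ} (hT : 0 ≤ T) (hC : IsAprioriBound b p x₀ T C) :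
    |x₀| ≤ C := by
  refine hC 0 ⟨le_rfl, hT⟩ (fun _ => x₀) ⟨continuous_const, fun r hr => ?_⟩ rfl
  obtain rfl : r = 0 := le_antisymm hr.2 hr.1
  simp

lemma exists_lipschitzWith_bounded_comp_projIcc (hb : LocallyLipschitz b) {a c : ℝ} (hac : a ≤ c) :
    ∃ (K : ℝ≥0) (C : ℝ), LipschitzWith K (fun z => b (projIcc a c hac z)) ∧
      ∀ z, ‖b (projIcc a c hac z)‖ ≤ C := by
  obtain ⟨K, hK⟩ := (hb.locallyLipschitzOn (s := Icc a c)).exists_lipschitzOnWith_of_compact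
    isCompact_Icc
  obtain ⟨C, hC⟩ := isCompact_Icc.exists_bound_of_continuousOn (hb.continuous.continuousOn)
  exact ⟨K * 1, C, (lipschitzOnWith_iff_restrict.1 hK).comp (LipschitzWith.projIcc hac),
    fun z => hC _ (projIcc a c hac z).2⟩

/-- Solve with the drift frozen outside the ball of radius `C + 1`: at the first exit from that
ball the solution would violate the a priori bound. -/
lemma IsAprioriBound.exists_isDriven {T C : ℝ} (hC : IsAprioriBound b p x₀ T C)
    (hb : LocallyLipschitz b) (hp : Continuous p) (hT : 0 ≤ T) :
    ∃ x, IsDriven b p x 0 T ∧ x 0 = x₀ := by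
  have hx₀ : |x₀| ≤ C := hC.abs_start_le hT
  have hC' : -(C + 1) ≤ C + 1 := by linarith [abs_nonneg x₀]
  set g : ℝ → ℝ := fun z => b (projIcc (-(C + 1)) (C + 1) hC' z)
  obtain ⟨K, L, hK, hL⟩ := exists_lipschitzWith_bounded_comp_projIcc hb hC'
  obtain ⟨x, hx, hx0⟩ := exists_isDriven_of_lipschitzWith_of_bounded hK hL hp x₀ hT
  have hgb : ∀ z, |z| ≤ C + 1 → g z = b z := fun z hz => by
    simp only [g, projIcc_of_mem hC' (abs_le.1 hz)]
  have no_exit : ∀ u ∈ Icc 0 T, |x u| ≤ C + 1 := by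
    by_contra! hexit
    obtain ⟨u, hu, hlt⟩ := hexit
    obtain ⟨r, hr, hr_eq, hr_le⟩ := exists_first_visit hx.continuous.abs hu.1
      (by rw [hx0]; linarith) hlt.le
    have hxr : IsDriven b p x 0 r := (hx.mono hK.continuous le_rfl (hr.2.trans hu.2)).congr_drift
      fun v hv => hgb _ (hr_le v hv)
    have := hC r ⟨hr.1, hr.2.trans hu.2⟩ x hxr hx0
    rw [Real.norm_eq_abs, hr_eq] at this
    linarith
  exact ⟨x, hx.congr_drift fun u hu => hgb _ (no_exit u hu), hx0⟩

lemma exists_isGlobalDriven (hb : LocallyLipschitz b) (hp : Continuous p)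
    (hC : ∀ T, 0 ≤ T → ∃ C, IsAprioriBound b p x₀ T C) : ∃ x, IsGlobalDriven b p x 0 x₀ := by
  have (n : ℕ) : ∃ x, IsDriven b p x 0 n ∧ x 0 = x₀ := by
    obtain ⟨C, hC'⟩ := hC n n.cast_nonneg
    exact hC'.exists_isDriven hb hp n.cast_nonneg
  choose y hy hy0 using this
  have consistent (m n : ℕ) : EqOn (y m) (y n) (Icc 0 (min m n)) :=
    ((hy m).mono hb.continuous le_rfl (min_le_left _ _)).eqOn_of_eq_left hb
      ((hy n).mono hb.continuous le_rfl (min_le_right _ _)) (by rw [hy0, hy0])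
  set x : ℝ → ℝ := fun u => y ⌈u⌉₊ (max u 0)
  have hxy : ∀ n : ℕ, ∀ u ≤ (n : ℝ), x u = y n (max u 0) := fun n u hu =>
    consistent _ _ ⟨le_max_right _ _, le_min (max_le (Nat.le_ceil u) (Nat.cast_nonneg _))
      (max_le hu n.cast_nonneg)⟩
  have hx : Continuous x := by
    refine continuous_iff_continuousAt.2 fun u => ?_
    obtain ⟨n, hn⟩ := exists_nat_gt u
    refine ContinuousAt.congr ?_
      (eventually_of_mem (Iic_mem_nhds hn) fun v hv => (hxy n v hv).symm)
    exact ((hy n).continuous.comp (continuous_id.max continuous_const)).continuousAt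
  refine ⟨x, fun t => ?_, by simp [x, hy0]⟩
  obtain ⟨n, hn⟩ := exists_nat_ge t
  refine ((hy n).mono hb.continuous le_rfl hn).congr_path hx fun u hu => ?_
  rw [hxy n u (hu.2.trans hn), max_eq_left hu.1]

end GlobalExistence

section Comparison

/-- `dx = b(x) du + dp` has a global solution from every integer at every nonnegative rational
time. A comparison with these countably many solutions suffices, and countably many events of full
probability can be intersected. -/
def HasRationalRestarts (b p : ℝ → ℝ) : Prop :=
  ∀ (q : ℚ≥0) (n : ℤ), ∃ z, IsGlobalDriven b p z q n

variable {b g p : ℝ → ℝ}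

lemma HasRationalRestarts.neg (h : HasRationalRestarts b p) :
    HasRationalRestarts (fun z => -b (-z)) (fun u => -p u) := fun q n => by
  obtain ⟨z, hz⟩ := h q (-n)
  exact ⟨_, by simpa using hz.neg⟩

lemma IsDriven.exists_le_crossing_time (hg : Continuous g) (hp : Continuous p) {a c : ℝ}
    (hac : a < c) (T : ℝ) : ∃ δ > 0, ∀ x s r, 0 ≤ s → s ≤ r → r ≤ T → IsDriven g p x s r →
      (∀ u ∈ Icc s r, x u ∈ Icc a c) → x s = a → x r = c → δ ≤ r - s := by
  obtain ⟨L, hL⟩ := (isCompact_Icc (a := a) (b := c)).exists_bound_of_continuousOn hg.continuousOn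
  have hL0 : 0 ≤ L := (norm_nonneg _).trans (hL a ⟨le_rfl, hac.le⟩)
  obtain ⟨δ, hδ, hpδ⟩ := Metric.uniformContinuousOn_iff.1
    (isCompact_Icc.uniformContinuousOn_of_continuous (hp.continuousOn (s := Icc 0 T)))
    ((c - a) / 2) (by linarith)
  refine ⟨min δ ((c - a) / (2 * (L + 1))), by
    have : 0 < c - a := sub_pos.2 hac
    positivity, fun x s r hs hsr hrT hx hxac hxs hxr => ?_⟩
  by_contra! hlt
  obtain ⟨hlt_δ, hlt_L⟩ := lt_min_iff.1 hlt
  have drift_le : ‖∫ u in s..r, g (x u)‖ ≤ L * |r - s| :=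
    intervalIntegral.norm_integral_le_of_norm_le_const fun u hu => by
      rw [uIoc_of_le hsr] at hu
      exact hL _ (hxac u ⟨hu.1.le, hu.2⟩)
  have forcing_lt : |p r - p s| < (c - a) / 2 :=
    hpδ r ⟨hs.trans hsr, hrT⟩ s ⟨hs, hsr.trans hrT⟩
      (by rwa [Real.dist_eq, abs_of_nonneg (sub_nonneg.2 hsr)])
  have increment := hx.eq r ⟨hsr, le_rfl⟩
  rw [lt_div_iff₀ (by positivity)] at hlt_L
  rw [Real.norm_eq_abs, abs_of_nonneg (sub_nonneg.2 hsr)] at drift_le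
  nlinarith [le_abs_self (∫ u in s..r, g (x u)), le_abs_self (p r - p s)]

lemma exists_nat_div_mem_Icc {m : ℕ} {s r : ℝ} (hm : 0 < m) (hs : 0 ≤ s) (hsr : 1 / m ≤ r - s) :
    ∃ j : ℕ, (j / m : ℝ) ∈ Icc s r := by
  have hm' : (0 : ℝ) < m := Nat.cast_pos.2 hm
  refine ⟨⌈s * m⌉₊, (le_div_iff₀ hm').2 (Nat.le_ceil _), ?_⟩
  rw [div_le_iff₀ hm'] at hsr ⊢
  linarith [Nat.ceil_lt_add_one (mul_nonneg hs hm'.le)]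

/-- A path reaching a high level must first cross `[N, N + 1]`. The crossing takes so long that it
contains a point of a fixed time grid, and from that point on the path is dominated by the solution
of the equation with drift `b` restarted there from `N + 1`. -/
lemma HasRationalRestarts.exists_upper_bound (hz : HasRationalRestarts b p)
    (hb : LocallyLipschitz b) (hg : Continuous g) (hp : Continuous p) {K : ℝ}
    (hK : ∀ z, K ≤ z → g z = b z) (x₀ T : ℝ) :
    ∃ C, ∀ t ∈ Icc 0 T, ∀ x, IsDriven g p x 0 t → x 0 = x₀ → x t ≤ C := by
  obtain ⟨N, hN⟩ := exists_nat_ge (max K x₀)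
  obtain ⟨hKN, hx₀N⟩ := max_le_iff.1 hN
  obtain ⟨δ, hδ, crossing_time⟩ := IsDriven.exists_le_crossing_time hg hp (lt_add_one (N : ℝ)) T
  obtain ⟨m, hm⟩ := exists_nat_one_div_lt hδ
  choose z hz using fun j : ℕ => hz (j / (m + 1 : ℕ)) (N + 1)
  obtain ⟨C, hC⟩ := ((Finset.range (⌈T * (m + 1 : ℕ)⌉₊ + 1)).isCompact_biUnion fun j _ =>
    (isCompact_Icc (a := 0) (b := T)).image ((hz j).isDriven T).continuous).bddAbove
  refine ⟨max (N + 1) C, fun t ht x hx hx0 => ?_⟩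
  obtain hxt | hxt := le_total (x t) (N + 1)
  · exact le_max_of_le_left hxt
  refine le_max_of_le_right ?_
  obtain ⟨s, r, hs, hsr, hrt, hxs, hxr, hge, hle⟩ := exists_upcrossing hx.continuous ht.1
    (hx0.trans_le hx₀N) (le_add_of_nonneg_right zero_le_one) hxt
  have long : δ ≤ r - s := crossing_time x s r hs hsr (hrt.trans ht.2)
    (hx.mono hg hs hrt) (fun u hu => ⟨hge u ⟨hu.1, hu.2.trans hrt⟩, hle u hu⟩) hxs hxr
  obtain ⟨j, hsj, hjr⟩ := exists_nat_div_mem_Icc m.succ_pos hs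
    ((by push_cast; exact hm.le : (1 : ℝ) / (m + 1 : ℕ) ≤ δ).trans long)
  have hxb : IsDriven b p x (j / (m + 1 : ℕ)) t :=
    (hx.mono hg (hs.trans hsj) le_rfl).congr_drift
      fun u hu => hK _ (hKN.trans (hge u ⟨hsj.trans hu.1, hu.2⟩))
  have hzj : IsGlobalDriven b p (z j) (j / (m + 1 : ℕ)) (N + 1) := by simpa using hz j
  have dominated : x t ≤ z j t := hxb.le_of_le_left hb (hzj.isDriven t)
    ((hle _ ⟨hsj, hjr⟩).trans_eq hzj.start.symm) t ⟨hjr.trans hrt, le_rfl⟩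
  refine dominated.trans (hC (mem_biUnion (x := j) ?_ ⟨t, ht, rfl⟩))
  have hjT := hjr.trans (hrt.trans ht.2)
  rw [div_le_iff₀ (Nat.cast_pos.2 m.succ_pos)] at hjT
  rw [Finset.mem_coe, Finset.mem_range, Nat.lt_succ_iff]
  exact Nat.cast_le.1 (hjT.trans (Nat.le_ceil _))

lemma HasRationalRestarts.exists_isAprioriBound (hz : HasRationalRestarts b p)
    (hb : LocallyLipschitz b) (hg : Continuous g) (hp : Continuous p) {K : ℝ}
    (hK : ∀ z, K ≤ |z| → g z = b z) (x₀ T : ℝ) : ∃ C, IsAprioriBound g p x₀ T C := by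
  obtain ⟨C₁, upper⟩ := hz.exists_upper_bound hb hg hp (fun z h => hK z (h.trans (le_abs_self z)))
    x₀ T
  have hneg : LocallyLipschitz (Neg.neg : ℝ → ℝ) := (LipschitzWith.neg .id).locallyLipschitz
  obtain ⟨C₂, lower⟩ := hz.neg.exists_upper_bound (hneg.comp (hb.comp hneg))
    (g := fun z => -g (-z)) (hg.comp continuous_neg).neg hp.neg (K := K)
    (fun z h => by rw [hK (-z) (by rw [abs_neg]; exact h.trans (le_abs_self z))]) (-x₀) T
  refine ⟨max C₁ C₂, fun t ht x hx hx0 => abs_le.2 ⟨?_, ?_⟩⟩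
  · exact neg_le.1 ((lower t ht _ hx.neg (by rw [hx0])).trans (le_max_right C₁ C₂))
  · exact (upper t ht x hx hx0).trans (le_max_left _ _)

end Comparison

section Euler

variable {E : Type*} [NormedAddCommGroup E] [NormedSpace ℝ E]

/-- The explicit Euler scheme of step `h` for `dx = b(x) du + dp`. Its iterates depend only on
finitely many values of `p`, which is what makes solutions adapted. -/
noncomputable def euler (b : E → E) (p : ℝ → E) (x₀ : E) (h : ℝ) : ℕ → E
  | 0 => x₀
  | k + 1 => euler b p x₀ h k + h • b (euler b p x₀ h k) + (p ((k + 1) * h) - p (k * h))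

variable {b : E → E} {p x : ℝ → E} {K : ℝ≥0}

lemma IsDriven.norm_sub_euler_step_le [CompleteSpace E] {r r' η : ℝ} (hb : LipschitzWith K b)
    (hx : IsDriven b p x r r') (hr : r ≤ r') (hη : ∀ u ∈ Icc r r', ‖x u - x r‖ ≤ η) :
    ‖x r' - (x r + (r' - r) • b (x r) + (p r' - p r))‖ ≤ K * η * (r' - r) := by
  have hc : Continuous fun u => b (x u) := hb.continuous.comp hx.continuous
  have error_eq : x r' - (x r + (r' - r) • b (x r) + (p r' - p r)) =
      ∫ u in r..r', (b (x u) - b (x r)) := by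
    rw [intervalIntegral.integral_sub (hc.intervalIntegrable _ _) (by simp),
      intervalIntegral.integral_const, hx.eq r' ⟨hr, le_rfl⟩]
    abel
  have := intervalIntegral.norm_integral_le_of_norm_le_const (a := r) (b := r')
    (f := fun u => b (x u) - b (x r)) (C := K * η) fun u hu => by
      rw [uIoc_of_le hr] at hu
      exact (hb.norm_sub_le _ _).trans (by gcongr; exact hη u ⟨hu.1.le, hu.2⟩)
  rwa [error_eq, ← abs_of_nonneg (sub_nonneg.2 hr)]

lemma IsDriven.norm_euler_succ_sub_le [CompleteSpace E] {x₀ : E} {h η : ℝ} {k : ℕ}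
    (hb : LipschitzWith K b) (hh : 0 ≤ h) (hx : IsDriven b p x (k * h) ((k + 1) * h))
    (hη : ∀ u ∈ Icc (k * h) ((k + 1) * h), ‖x u - x (k * h)‖ ≤ η) :
    ‖euler b p x₀ h (k + 1) - x ((k + 1) * h)‖ ≤
      (1 + h * K) * ‖euler b p x₀ h k - x (k * h)‖ + K * η * h := by
  have hkh : (k : ℝ) * h ≤ (k + 1) * h := by gcongr; linarith
  have local_error := hx.norm_sub_euler_step_le hb hkh hη
  rw [show ((k : ℝ) + 1) * h - k * h = h by ring] at local_error
  set X := x (k * h)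
  set Y := euler b p x₀ h k
  set X' := x ((k + 1) * h)
  have split : euler b p x₀ h (k + 1) - X' = (Y - X) + h • (b Y - b X) -
      (X' - (X + h • b X + (p ((k + 1) * h) - p (k * h)))) := by
    simp only [euler, smul_sub, Y]
    abel
  calc ‖euler b p x₀ h (k + 1) - X'‖ ≤ ‖Y - X‖ + ‖h • (b Y - b X)‖ + K * η * h := by
        rw [split]
        exact (norm_sub_le _ _).trans (add_le_add (norm_add_le _ _) local_error)
    _ ≤ ‖Y - X‖ + h * (K * ‖Y - X‖) + K * η * h := by
        rw [norm_smul, Real.norm_of_nonneg hh]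
        gcongr
        exact hb.norm_sub_le Y X
    _ = (1 + h * K) * ‖Y - X‖ + K * η * h := by ring

lemma IsDriven.norm_euler_sub_le [CompleteSpace E] {h η : ℝ} {N : ℕ} (hb : LipschitzWith K b)
    (hh : 0 ≤ h) (hη0 : 0 ≤ η) (hx : IsDriven b p x 0 (N * h))
    (hη : ∀ k < N, ∀ u ∈ Icc (k * h) ((k + 1) * h), ‖x u - x (k * h)‖ ≤ η) :
    ‖euler b p (x 0) h N - x (N * h)‖ ≤ N * (K * η * h) * Real.exp (N * (h * K)) := by
  set e : ℕ → ℝ := fun k => ‖euler b p (x 0) h k - x (k * h)‖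
  have step : ∀ k < N, e (k + 1) ≤ (1 + h * K) * e k + K * η * h := by
    intro k hk
    have hk1 : ((k : ℝ) + 1) * h ≤ N * h := by
      gcongr
      exact_mod_cast hk
    simpa only [e, Nat.cast_add, Nat.cast_one] using
      (hx.mono hb.continuous (by positivity) hk1).norm_euler_succ_sub_le hb hh (hη k hk)
  -- The Gronwall lemma wants the recursion for all indices: freeze the sequence after `N`.
  have := discrete_gronwall (u := fun k => e (min k N)) (b := fun _ => K * η * h)
    (c := fun _ => h * K) (n₀ := 0) (norm_nonneg _) (fun k _ => by
      obtain hk | hk := lt_or_ge k N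
      · rw [min_eq_left hk.le, min_eq_left (Nat.succ_le_of_lt hk)]
        exact step k hk
      · rw [min_eq_right hk, min_eq_right (hk.trans k.le_succ)]
        have : 0 ≤ h * K * e N := mul_nonneg (by positivity) (norm_nonneg _)
        have : 0 ≤ K * η * h := by positivity
        linarith)
    (fun _ _ => by positivity) (fun _ _ => by positivity) N.zero_le
  simpa [e, euler] using this

lemma IsDriven.tendsto_euler [CompleteSpace E] {t : ℝ} (hb : LipschitzWith K b) (ht : 0 ≤ t)
    (hx : IsDriven b p x 0 t) :
    Tendsto (fun N : ℕ => euler b p (x 0) (t / N) N) atTop (𝓝 (x t)) := by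
  rw [Metric.tendsto_atTop]
  intro ε hε
  set A := t * K * Real.exp (t * K)
  have : 0 ≤ A := by positivity
  obtain ⟨δ, hδ, hxδ⟩ := Metric.uniformContinuousOn_iff.1
    (isCompact_Icc.uniformContinuousOn_of_continuous (hx.continuous.continuousOn (s := Icc 0 t)))
    (ε / (A + 1)) (by positivity)
  obtain ⟨N₀, hN₀⟩ := exists_nat_gt (t / δ)
  refine ⟨N₀ + 1, fun N hN => ?_⟩
  have hN' : (N₀ : ℝ) + 1 ≤ N := by exact_mod_cast hN
  have hNpos : (0 : ℝ) < N := by linarith [N₀.cast_nonneg (α := ℝ)]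
  have hNt : N * (t / N) = t := mul_div_cancel₀ t hNpos.ne'
  have step_lt : t / N < δ := by
    rw [div_lt_iff₀ hδ] at hN₀
    rw [div_lt_iff₀ hNpos]
    nlinarith
  have osc : ∀ k < N, ∀ u ∈ Icc (k * (t / N)) ((k + 1) * (t / N)),
      ‖x u - x (k * (t / N))‖ ≤ ε / (A + 1) := fun k hk u hu => by
    have hk0 : 0 ≤ k * (t / N) := by positivity
    have hut : u ≤ t := hu.2.trans (by
      conv_rhs => rw [← hNt]
      gcongr
      exact_mod_cast hk)
    rw [← dist_eq_norm]
    refine (hxδ u ⟨hk0.trans hu.1, hut⟩ _ ⟨hk0, hu.1.trans hut⟩ ?_).le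
    rw [Real.dist_eq, abs_of_nonneg (sub_nonneg.2 hu.1)]
    linarith [hu.2]
  have error_le := IsDriven.norm_euler_sub_le (N := N) hb (by positivity : 0 ≤ t / N)
    (by positivity : 0 ≤ ε / (A + 1)) (by rwa [hNt]) osc
  rw [hNt] at error_le
  rw [dist_eq_norm]
  calc _ ≤ N * (K * (ε / (A + 1)) * (t / N)) * Real.exp (N * (t / N * K)) := error_le
    _ = N * (t / N) * K * Real.exp (N * (t / N) * K) * (ε / (A + 1)) := by ring_nf
    _ = ε * (A / (A + 1)) := by rw [hNt]; ring
    _ < ε := mul_lt_of_lt_one_right hε ((div_lt_one (by positivity)).2 (lt_add_one A))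

end Euler

section StrongSolutions

variable {Ω : Type} {B : ℝ≥0 → Ω → ℝ} {b : ℝ → ℝ}

/-- The sample path `s ↦ √2 B_s(ω)`, extended to negative times by a constant. -/
noncomputable def noise (B : ℝ≥0 → Ω → ℝ) (w : Ω) (s : ℝ) : ℝ := √2 * B s.toNNReal w

lemma continuous_noise {w : Ω} (h : Continuous fun t => B t w) : Continuous (noise B w) :=
  continuous_const.mul (h.comp continuous_real_toNNReal)

lemma measurable_euler_noise {m : MeasurableSpace Ω} (hb : Measurable b) {h : ℝ} {c : Ω → ℝ}
    (hc : Measurable c) (N : ℕ) (hB : ∀ k ≤ N, Measurable (B ((k : ℝ) * h).toNNReal)) :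
    ∀ k ≤ N, Measurable fun w => euler b (noise B w) (c w) h k
  | 0, _ => hc
  | k + 1, hk => by
    have euler_k := measurable_euler_noise hb hc N hB k (by omega)
    have B_k1 := hB (k + 1) hk
    push_cast at B_k1
    simp only [euler, noise]
    exact (euler_k.add ((hb.comp euler_k).const_mul h)).add
      ((B_k1.const_mul _).sub ((hB k (by omega)).const_mul _))

variable [MeasurableSpace Ω] {P : Measure Ω} {x₀ : ℝ}

/-- On the event that the solution stays in `[-n, n]` it is a limit of Euler schemes with drift
frozen outside `[-n, n]`, which are functions of `(B_s)_{s ≤ t}`. -/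
lemma aestronglyMeasurable_of_ae_isDriven (hb : LocallyLipschitz b) {x : Ω → ℝ → ℝ} {t : ℝ≥0}
    (hx : ∀ᵐ w ∂P, IsDriven b (noise B w) (x w) 0 t ∧ x w 0 = x₀ + noise B w 0) :
    AEStronglyMeasurable[⨆ s ≤ t, MeasurableSpace.comap (B s) inferInstance]
      (fun w => x w t) P := by
  have hn (n : ℕ) : -(n : ℝ) ≤ n := neg_le_self n.cast_nonneg
  set g : ℕ → ℝ → ℝ := fun n z => b (projIcc (-(n : ℝ)) n (hn n) z)
  set m : MeasurableSpace Ω := ⨆ s ≤ t, MeasurableSpace.comap (B s) inferInstance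
  have hB : ∀ s ≤ t, Measurable[m] (B s) :=
    fun s hs => (comap_measurable (B s)).mono (le_iSup₂_of_le s hs le_rfl) le_rfl
  refine ⟨fun w => limUnder atTop fun n : ℕ => limUnder atTop fun N : ℕ =>
    euler (g n) (noise B w) (x₀ + noise B w 0) (t / N) N,
    StronglyMeasurable.limUnder fun n => StronglyMeasurable.limUnder fun N => ?_, ?_⟩
  · have hg : Continuous (g n) := by
      exact hb.continuous.comp (continuous_subtype_val.comp continuous_projIcc)
    have measurable_start : Measurable[m] fun w => x₀ + noise B w 0 :=
      ((hB _ (by simp)).const_mul _).const_add _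
    refine Measurable.stronglyMeasurable (measurable_euler_noise hg.measurable measurable_start N
      (fun k hk => hB _ ?_) N le_rfl)
    rw [Real.toNNReal_le_iff_le_coe, ← mul_div_assoc]
    exact div_le_of_le_mul₀ (by positivity) t.2 (by rw [mul_comm]; gcongr)
  · filter_upwards [hx] with w ⟨hw, hw0⟩
    obtain ⟨M, hM⟩ := isCompact_Icc.exists_bound_of_continuousOn
      (hw.continuous.continuousOn (s := Icc 0 (t : ℝ)))
    obtain ⟨n₀, hn₀⟩ := exists_nat_ge M
    refine (tendsto_const_nhds.congr' ?_).limUnder_eq.symm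
    filter_upwards [eventually_ge_atTop n₀] with n hn₀n
    obtain ⟨K, -, hK, -⟩ := exists_lipschitzWith_bounded_comp_projIcc hb (hn n)
    have hwn : IsDriven (g n) (noise B w) (x w) 0 t := hw.congr_drift fun u hu => by
      have : |x w u| ≤ n := (hM u hu).trans (hn₀.trans (Nat.cast_le.2 hn₀n))
      simp only [g, projIcc_of_mem (hn n) (abs_le.1 this)]
    rw [← hw0]
    exact (hwn.tendsto_euler hK t.2).limUnder_eq.symm

lemma isStrongSolution_of_ae_isGlobalDriven (hb : LocallyLipschitz b) {x : Ω → ℝ → ℝ}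
    (hx : ∀ᵐ w ∂P, IsGlobalDriven b (noise B w) (x w) 0 (x₀ + noise B w 0)) :
    IsStrongSolution P B b x₀ fun t w => x w t where
  adapted t := aestronglyMeasurable_of_ae_isDriven hb <| by
    filter_upwards [hx] with w hw using ⟨hw.isDriven t, hw.start⟩
  continuous := by
    filter_upwards [hx] with w hw
    exact (hw.isDriven 0).continuous.comp NNReal.continuous_coe
  equation := by
    filter_upwards [hx] with w hw t
    have toNNReal_eq : ∫ s in (0 : ℝ)..t, b (x w s.toNNReal) = ∫ s in (0 : ℝ)..t, b (x w s) := by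
      refine intervalIntegral.integral_congr fun s hs => ?_
      rw [uIcc_of_le t.coe_nonneg] at hs
      simp only [Real.coe_toNNReal s hs.1]
    rw [(hw.isDriven t).eq t ⟨t.2, le_rfl⟩, toNNReal_eq, hw.start]
    simp only [noise, Real.toNNReal_coe]
    ring

lemma IsStrongSolution.ae_isGlobalDriven {X : ℝ≥0 → Ω → ℝ} (hX : IsStrongSolution P B b x₀ X) :
    ∀ᵐ w ∂P, IsGlobalDriven b (noise B w) (fun s => X s.toNNReal w) 0 (x₀ + noise B w 0) := by
  filter_upwards [hX.continuous, hX.equation] with w hc he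
  have start : X 0 w = x₀ + √2 * B 0 w := by simpa using he 0
  refine ⟨fun t => ⟨hc.comp continuous_real_toNNReal, fun r hr => ?_⟩, by simpa [noise] using start⟩
  have := he r.toNNReal
  rw [Real.coe_toNNReal r hr.1] at this
  simp only [noise, Real.toNNReal_zero, start, this]
  ring

lemma exists_unique_isStrongSolution (hb : LocallyLipschitz b)
    (hB : ∀ᵐ w ∂P, Continuous fun t => B t w)
    (hC : ∀ᵐ w ∂P, ∀ T, 0 ≤ T → ∃ C, IsAprioriBound b (noise B w) (x₀ + noise B w 0) T C) :
    ∃ X : ℝ≥0 → Ω → ℝ, IsStrongSolution P B b x₀ X ∧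
      ∀ Y : ℝ≥0 → Ω → ℝ, IsStrongSolution P B b x₀ Y → ∀ᵐ w ∂P, ∀ t, Y t w = X t w := by
  have (w : Ω) : ∃ x, (∃ x, IsGlobalDriven b (noise B w) x 0 (x₀ + noise B w 0)) →
      IsGlobalDriven b (noise B w) x 0 (x₀ + noise B w 0) := by
    by_cases h : ∃ x, IsGlobalDriven b (noise B w) x 0 (x₀ + noise B w 0)
    exacts [h.imp fun x hx _ => hx, ⟨0, fun h' => absurd h' h⟩]
  choose x hx using this
  have global : ∀ᵐ w ∂P, IsGlobalDriven b (noise B w) (x w) 0 (x₀ + noise B w 0) := by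
    filter_upwards [hC, hB] with w hCw hBw
    exact hx w (exists_isGlobalDriven hb (continuous_noise hBw) hCw)
  refine ⟨fun t w => x w t, isStrongSolution_of_ae_isGlobalDriven hb global, fun Y hY => ?_⟩
  filter_upwards [global, hY.ae_isGlobalDriven] with w hxw hYw t
  simpa using (hYw.isDriven t).eqOn_of_eq_left hb (hxw.isDriven t)
    (hYw.start.trans hxw.start.symm) ⟨t.2, le_rfl⟩

lemma stronglyWellPosed_of_bounded (hb : LocallyLipschitz b) {C : ℝ} (hC : ∀ z, |b z| ≤ C) :
    StronglyWellPosed b := by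
  intro x₀ Ω _ P _ B _ hB
  refine exists_unique_isStrongSolution hb hB.cont ?_
  filter_upwards [hB.cont] with w hw T hT
  obtain ⟨M, hM⟩ := (isCompact_Icc (a := 0) (b := T)).exists_bound_of_continuousOn
    (continuous_noise hw).continuousOn
  have hC0 : 0 ≤ C := (abs_nonneg _).trans (hC 0)
  refine ⟨|x₀ + noise B w 0| + C * T + (M + M), fun t ht x hx hx0 => ?_⟩
  have drift_le : ‖∫ u in (0 : ℝ)..t, b (x u)‖ ≤ C * |t - 0| :=
    intervalIntegral.norm_integral_le_of_norm_le_const fun u _ => hC _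
  rw [sub_zero, abs_of_nonneg ht.1] at drift_le
  rw [hx.eq t ⟨ht.1, le_rfl⟩, hx0]
  calc _ ≤ |x₀ + noise B w 0| + ‖∫ u in (0 : ℝ)..t, b (x u)‖ + (‖noise B w t‖ + ‖noise B w 0‖) :=
        (norm_add_le _ _).trans (add_le_add (norm_add_le _ _) (norm_sub_le _ _))
    _ ≤ _ := by
        gcongr
        exacts [drift_le.trans (by gcongr; exact ht.2), hM t ht, hM 0 ⟨le_rfl, hT⟩]

lemma StronglyWellPosed.ae_hasRationalRestarts (hwp : StronglyWellPosed b) [IsProbabilityMeasure P]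
    (hBm : ∀ t, Measurable (B t)) (hB : IsBrownianReal B P) :
    ∀ᵐ w ∂P, HasRationalRestarts b (noise B w) := by
  simp only [HasRationalRestarts, ae_all_iff]
  intro q n
  obtain ⟨X, hX, -⟩ := hwp n Ω P (fun t w => B (q + t) w - B q w)
    (fun t => (hBm _).sub (hBm _)) (hB.shift q)
  filter_upwards [hX.ae_isGlobalDriven] with w hw
  refine ⟨fun u => X (u - q).toNNReal w, fun t => ?_, by simpa [noise] using hw.start⟩
  have shifted := (hw.isDriven (t - q)).comp_sub_right q
  rw [zero_add, sub_add_cancel] at shifted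
  refine shifted.congr_forcing fun r hr => ?_
  have hq : (q : ℝ).toNNReal = (q : ℝ≥0) := Real.toNNReal_coe (r := (q : ℝ≥0))
  have time_eq : (q : ℝ≥0) + (r - q).toNNReal = r.toNNReal := by
    rw [← hq, ← Real.toNNReal_add (NNRat.cast_nonneg q) (sub_nonneg.2 hr.1), add_sub_cancel]
  simp only [noise, time_eq, hq, sub_self, Real.toNNReal_zero, add_zero]
  ring

lemma StronglyWellPosed.of_eq_off_compact {g : ℝ → ℝ} (hwp : StronglyWellPosed b)
    (hb : LocallyLipschitz b) (hg : LocallyLipschitz g) {K : ℝ} (hK : ∀ z, K ≤ |z| → g z = b z) :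
    StronglyWellPosed g := by
  intro x₀ Ω _ P _ B hBm hB
  refine exists_unique_isStrongSolution hg hB.cont ?_
  filter_upwards [hwp.ae_hasRationalRestarts hBm hB, hB.cont] with w hw hc T _
  exact hw.exists_isAprioriBound hb hg.continuous (continuous_noise hc) hK _ T

end StrongSolutions

section Calculus

variable {E : Type*} [NormedAddCommGroup E] [NormedSpace ℝ E]

lemma contDiff_primitive [CompleteSpace E] {u : ℝ → E} (hu : ContDiff ℝ ∞ u) (a : ℝ) :
    ContDiff ℝ ∞ fun x => ∫ y in a..x, u y := by
  refine contDiff_infty_iff_deriv.2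
    ⟨fun x => (hu.continuous.integral_hasStrictDerivAt a x).hasDerivAt.differentiableAt, ?_⟩
  rwa [funext (hu.continuous.deriv_integral u a)]

lemma contDiff_of_periodic {n : ℕ∞} {u : ℝ → E} {a T : ℝ} (hT : 0 < T)
    (hper : Function.Periodic u T) (hu : ∀ x ∈ Ioc a (a + T), ContDiffAt ℝ n u x) :
    ContDiff ℝ n u := by
  refine contDiff_iff_contDiffAt.2 fun x => ?_
  set k := toIocDiv hT a x
  have translate : u = u ∘ fun y => y - k • T := funext fun y => (hper.sub_zsmul_eq k).symm
  rw [translate]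
  exact ContDiffAt.comp x (hu _ (sub_toIocDiv_zsmul_mem_Ioc hT a x)) (by fun_prop)

lemma exists_contDiff_periodic_eqOn {n : ℕ∞} {g : ℝ → E} {a T : ℝ} (hT : 0 < T)
    (hg : ContDiff ℝ n g) (hs : tsupport g ⊆ Ioo a (a + T)) :
    ∃ u, ContDiff ℝ n u ∧ Function.Periodic u T ∧ EqOn u g (Ioc a (a + T)) := by
  set u : ℝ → E := fun x => g (toIocMod hT a x)
  have hper : Function.Periodic u T := fun x => by simp only [u, toIocMod_add_right]
  have hug : EqOn u g (Ioc a (a + T)) := fun x hx =>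
    congrArg g ((toIocMod_eq_self hT).2 hx)
  refine ⟨u, contDiff_of_periodic (a := a) hT hper fun x hx => ?_, hper, hug⟩
  rcases hx.2.lt_or_eq with hlt | rfl
  · refine hg.contDiffAt.congr_of_eventuallyEq ?_
    filter_upwards [Ioo_mem_nhds hx.1 hlt] with y hy using hug (Ioo_subset_Ioc_self hy)
  · -- Both one-sided germs of `u` at the junction point are germs of `g` off its support.
    have left : ∀ᶠ y in 𝓝 (a + T), g y = 0 :=
      notMem_tsupport_iff_eventuallyEq.1 fun h => lt_irrefl _ (hs h).2
    have right : ∀ᶠ y in 𝓝 (a + T), g (y - T) = 0 := by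
      have near_left_end : g =ᶠ[𝓝 (a + T - T)] 0 := by
        rw [add_sub_cancel_right]
        exact notMem_tsupport_iff_eventuallyEq.1 fun h => lt_irrefl _ (hs h).1
      exact (continuous_sub_right T).continuousAt.eventually near_left_end
    refine (contDiffAt_const (c := (0 : E))).congr_of_eventuallyEq ?_
    filter_upwards [left, right, Ioo_mem_nhds (lt_add_of_pos_right a hT)
      (lt_add_of_pos_right (a + T) hT)] with y hy_left hy_right hy
    rcases le_or_gt y (a + T) with hle | hlt
    · rw [hug ⟨hy.1, hle⟩, hy_left]
    · rw [← hper.sub_eq y, hug ⟨by linarith, by linarith [hy.2]⟩, hy_right]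

end Calculus

namespace Dom

/-- Compatibility of a function on `ℝ` with the domain: `2π`-periodicity on the torus, no condition
on the line. -/
def Per : Dom → (ℝ → ℝ) → Prop
  | .line, _ => True
  | .torus, u => Function.Periodic u (2 * Real.pi)

variable {D : Dom} {u v u' η : ℝ → ℝ}

lemma smooth_iff : D.Smooth u ↔ ContDiff ℝ ∞ u ∧ D.Per u := by
  cases D <;> simp only [Smooth, Per, and_true]

lemma Per.comp (g : ℝ → ℝ) (hu : D.Per u) : D.Per fun x => g (u x) := by
  cases D
  · trivial
  · exact fun x => congrArg g (hu x)

lemma Per.comp₂ (g : ℝ → ℝ → ℝ) (hu : D.Per u) (hv : D.Per v) : D.Per fun x => g (u x) (v x) := by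
  cases D
  · trivial
  · exact fun x => congrArg₂ g (hu x) (hv x)

lemma Per.deriv (hu : D.Per u) : D.Per (deriv u) := by
  cases D
  · trivial
  · intro x
    rw [← deriv_comp_add_const]
    exact congrFun (congrArg _root_.deriv (funext hu)) x

lemma Smooth.const (c : ℝ) : D.Smooth fun _ => c := by
  have h : ContDiff ℝ ∞ fun _ : ℝ => c := contDiff_const
  cases D
  exacts [h, ⟨h, fun _ => rfl⟩]

lemma SmoothCompact.zero : D.SmoothCompact 0 := by
  cases D
  exacts [⟨contDiff_const, HasCompactSupport.zero⟩, ⟨contDiff_const, fun _ => rfl⟩]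

lemma SmoothCompact.smooth (hη : D.SmoothCompact η) : D.Smooth η := by
  cases D
  exacts [hη.1, hη]

lemma SmoothCompact.contDiff (hη : D.SmoothCompact η) : ContDiff ℝ ∞ η :=
  (smooth_iff.1 hη.smooth).1

lemma SmoothCompact.continuous (hη : D.SmoothCompact η) : Continuous η := hη.contDiff.continuous

lemma SmoothCompact.hasDerivAt (hη : D.SmoothCompact η) (x : ℝ) :
    HasDerivAt η (_root_.deriv η x) x :=
  (hη.contDiff.differentiable (by simp) x).hasDerivAt

lemma SmoothCompact.deriv (hη : D.SmoothCompact η) : D.SmoothCompact (deriv η) := by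
  have h := (contDiff_infty_iff_deriv.1 hη.contDiff).2
  cases D
  exacts [⟨h, hη.2.deriv⟩, ⟨h, Per.deriv (D := .torus) hη.2⟩]

lemma SmoothCompact.mul_left (hu : D.Smooth u) (hη : D.SmoothCompact η) :
    D.SmoothCompact fun x => u x * η x := by
  have h := (smooth_iff.1 hu).1.mul hη.contDiff
  cases D
  exacts [⟨h, hη.2.mul_left⟩, ⟨h, Per.comp₂ (D := .torus) (· * ·) hu.2 hη.2⟩]

lemma SmoothCompact.add (hu : D.SmoothCompact u) (hv : D.SmoothCompact v) :
    D.SmoothCompact fun x => u x + v x := by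
  cases D
  exacts [⟨hu.1.add hv.1, hu.2.add hv.2⟩,
    ⟨hu.1.add hv.1, Per.comp₂ (D := .torus) (· + ·) hu.2 hv.2⟩]

lemma SmoothCompact.exists_abs_le (hη : D.SmoothCompact η) : ∃ C, ∀ x, |η x| ≤ C := by
  cases D
  · exact hη.2.exists_bound_of_continuous hη.1.continuous
  · obtain ⟨C, hC⟩ := (isCompact_Icc (a := 0) (b := 2 * Real.pi)).exists_bound_of_continuousOn
      hη.1.continuous.continuousOn
    refine ⟨C, fun x => ?_⟩
    obtain ⟨y, hy, hxy⟩ := hη.2.exists_mem_Ico₀ Real.two_pi_pos x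
    rw [hxy]
    exact hC y (Ico_subset_Icc_self hy)

instance : NeZero D.vol := by
  cases D
  · exact inferInstanceAs (NeZero (volume : Measure ℝ))
  · refine ⟨?_⟩
    rw [vol, Ne, Measure.restrict_eq_zero, Real.volume_Ioc, ENNReal.ofReal_eq_zero]
    linarith [Real.pi_pos]

instance : IsLocallyFiniteMeasure D.vol := by
  cases D <;> simp only [vol] <;> infer_instance

lemma neg_pi_add_two_pi : -Real.pi + 2 * Real.pi = Real.pi := by ring

lemma integral_torus (u : ℝ → ℝ) : ∫ x, u x ∂Dom.torus.vol = ∫ x in -Real.pi..Real.pi, u x := by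
  rw [intervalIntegral.integral_of_le (by linarith [Real.pi_pos])]
  rfl

lemma integrable_torus (hu : LocallyIntegrable u Dom.torus.vol) : Integrable u Dom.torus.vol := by
  have := hu.integrableOn_isCompact (isCompact_Icc (a := -Real.pi) (b := Real.pi))
  rwa [IntegrableOn, vol, Measure.restrict_restrict measurableSet_Icc,
    inter_eq_right.2 Ioc_subset_Icc_self] at this

lemma Per.primitive (hc : Continuous u) (hu : D.Per u)
    (h0 : D = .torus → ∫ x, u x ∂D.vol = 0) : D.Per fun x => ∫ y in (0 : ℝ)..x, u y := by
  cases D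
  · trivial
  · intro x
    have integral_period : ∫ y in x..x + 2 * Real.pi, u y = 0 := by
      rw [hu.intervalIntegral_add_eq x (-Real.pi), neg_pi_add_two_pi, ← integral_torus, h0 rfl]
    simp only
    rw [← intervalIntegral.integral_add_adjacent_intervals (hc.intervalIntegrable 0 x)
      (hc.intervalIntegrable x _), integral_period, add_zero]

lemma integrable_mul_smoothCompact (hu : LocallyIntegrable u D.vol) (hη : D.SmoothCompact η) :
    Integrable (fun x => u x * η x) D.vol := by
  cases D
  · simpa [mul_comm] using hu.integrable_smul_left_of_hasCompactSupport hη.1.continuous hη.2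
  · obtain ⟨C, hC⟩ := hη.exists_abs_le
    exact (integrable_torus hu).mul_bdd hη.continuous.aestronglyMeasurable (ae_of_all _ hC)

lemma integral_mul_deriv_smoothCompact (hu : ∀ x, HasDerivAt u (u' x) x) (hu' : Continuous u')
    (hper : D.Per u) (hη : D.SmoothCompact η) :
    ∫ x, u x * deriv η x ∂D.vol = -∫ x, u' x * η x ∂D.vol := by
  have hu₀ : Continuous u := continuous_iff_continuousAt.2 fun x => (hu x).continuousAt
  cases D
  · exact integral_mul_deriv_eq_deriv_mul_of_integrable (fun x _ => hu x)
      (fun x _ => hη.hasDerivAt x) (integrable_mul_smoothCompact hu₀.locallyIntegrable hη.deriv)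
      (integrable_mul_smoothCompact hu'.locallyIntegrable hη)
      (integrable_mul_smoothCompact hu₀.locallyIntegrable hη)
  · rw [integral_torus, integral_torus, intervalIntegral.integral_mul_deriv_eq_deriv_mul
      (fun x _ => hu x) (fun x _ => hη.hasDerivAt x) (hu'.intervalIntegrable _ _)
      (hη.deriv.continuous.intervalIntegrable _ _)]
    have u_pi := hper (-Real.pi)
    have η_pi := hη.2 (-Real.pi)
    rw [neg_pi_add_two_pi] at u_pi η_pi
    rw [u_pi, η_pi, sub_self, zero_sub]

lemma exists_cutoff (D : Dom) : ∃ χ : ℕ → ℝ → ℝ, (∀ n, D.SmoothCompact (χ n)) ∧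
    (∀ n x, χ n x ∈ Icc 0 1) ∧ ∀ (n : ℕ) (x : ℝ), |x| ≤ n → χ n x = 1 := by
  cases D
  · let β : ℕ → ContDiffBump (0 : ℝ) := fun n => ⟨n + 1, n + 2, by positivity, by linarith⟩
    refine ⟨fun n => β n, fun n => ⟨(β n).contDiff, (β n).hasCompactSupport⟩,
      fun n x => ⟨(β n).nonneg, (β n).le_one⟩, fun n x hx => (β n).one_of_mem_closedBall ?_⟩
    rw [mem_closedBall_zero_iff]
    exact hx.trans (by simp [β])
  · exact ⟨fun _ _ => 1, fun _ => Smooth.const (D := .torus) 1, by simp, by simp⟩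

lemma ae_eq_zero_of_integral_mul_smoothCompact (hu : LocallyIntegrable u D.vol)
    (h : ∀ η, D.SmoothCompact η → ∫ x, u x * η x ∂D.vol = 0) : u =ᵐ[D.vol] 0 := by
  cases D
  · refine ae_eq_zero_of_integral_contDiff_smul_eq_zero hu fun g hg hc => ?_
    simpa only [mul_comm, vol, smul_eq_mul] using h g ⟨hg, hc⟩
  · have hI : IntegrableOn u (Ioc (-Real.pi) Real.pi) := integrable_torus hu
    have := isOpen_Ioo.ae_eq_zero_of_integral_contDiff_smul_eq_zero (U := Ioo (-Real.pi) Real.pi)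
      (hI.mono_set Ioo_subset_Ioc_self).locallyIntegrableOn fun g hg _ hs => by
        obtain ⟨η, hη, hper, hηg⟩ := exists_contDiff_periodic_eqOn Real.two_pi_pos hg
          (by rwa [neg_pi_add_two_pi])
        rw [neg_pi_add_two_pi] at hηg
        rw [← h η ⟨hη, hper⟩, vol, ← setIntegral_eq_integral_of_forall_compl_eq_zero
          (s := Ioc (-Real.pi) Real.pi)]
        · exact setIntegral_congr_fun measurableSet_Ioc fun x hx => by
            simp only [hηg hx, smul_eq_mul, mul_comm]
        · intro x hx
          rw [image_eq_zero_of_notMem_tsupport fun hx' => hx (Ioo_subset_Ioc_self (hs hx')),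
            zero_smul]
    rw [vol, Measure.restrict_congr_set Ioo_ae_eq_Ioc.symm, EventuallyEq,
      ae_restrict_iff' measurableSet_Ioo]
    exact this

end Dom

section MeasureDomination

variable {α : Type*} [MeasurableSpace α] {μ ν : Measure α} {C : ℝ} {g : α → ℝ}

lemma integral_le_mul_of_le_smul (hC : 0 ≤ C) (hμν : μ ≤ ENNReal.ofReal C • ν)
    (hg0 : ∀ x, 0 ≤ g x) (hg : Integrable g ν) : ∫ x, g x ∂μ ≤ C * ∫ x, g x ∂ν := by
  have := integral_mono_measure hμν (ae_of_all _ hg0) (hg.smul_measure ENNReal.ofReal_ne_top)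
  rwa [integral_smul_measure, ENNReal.toReal_ofReal hC, smul_eq_mul] at this

lemma variance_le_mul_of_le_smul [IsProbabilityMeasure μ] [IsProbabilityMeasure ν] (hC : 0 ≤ C)
    (hμν : μ ≤ ENNReal.ofReal C • ν) (hg : MemLp g 2 ν) : Var[g; μ] ≤ C * Var[g; ν] := by
  have hgμ : MemLp g 2 μ := hg.of_measure_le_smul ENNReal.ofReal_ne_top hμν
  have centered := hg.sub (memLp_const (ν[g]))
  calc Var[g; μ] = Var[fun x => g x - ν[g]; μ] := (variance_sub_const hgμ.1 _).symm
    _ ≤ ∫ x, (g x - ν[g]) ^ 2 ∂μ :=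
        variance_le_expectation_sq (hgμ.1.sub aestronglyMeasurable_const)
    _ ≤ C * ∫ x, (g x - ν[g]) ^ 2 ∂ν :=
        integral_le_mul_of_le_smul hC hμν (fun _ => sq_nonneg _) centered.integrable_sq
    _ = C * Var[g; ν] := by rw [variance_eq_integral hg.1.aemeasurable]

end MeasureDomination

section Gibbs

/-- A continuous potential with finite partition function, so that `gibbs D W` is a probability
measure. -/
structure IsGibbsPotential (D : Dom) (W : ℝ → ℝ) : Prop where
  continuous : Continuous W
  integrable : Integrable (fun x => Real.exp (-W x)) D.vol

variable {D : Dom} {V W U f φ φ' ψ ψ' : ℝ → ℝ} {C : ℝ}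

lemma exp_mul_exp_neg (a : ℝ) : Real.exp a * Real.exp (-a) = 1 := by
  rw [← Real.exp_add, add_neg_cancel, Real.exp_zero]

namespace IsGibbsPotential

lemma partition_pos (hW : IsGibbsPotential D W) : 0 < partition D W :=
  integral_exp_pos hW.integrable

lemma measurable_density (hW : IsGibbsPotential D W) :
    Measurable fun x => ENNReal.ofReal (Real.exp (-W x) / partition D W) := by
  have := hW.continuous
  have : Continuous fun x => Real.exp (-W x) / partition D W := by fun_prop
  exact this.measurable.ennreal_ofReal

lemma ae_gibbs (hW : IsGibbsPotential D W) : ae (gibbs D W) = ae D.vol := by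
  refine le_antisymm (withDensity_absolutelyContinuous _ _).ae_le
    (withDensity_absolutelyContinuous' hW.measurable_density.aemeasurable
      (ae_of_all _ fun x => ?_)).ae_le
  have := hW.partition_pos
  exact (ENNReal.ofReal_pos.2 (by positivity)).ne'

lemma aestronglyMeasurable_gibbs_iff (hW : IsGibbsPotential D W) :
    AEStronglyMeasurable φ (gibbs D W) ↔ AEStronglyMeasurable φ D.vol := by
  simp only [AEStronglyMeasurable, EventuallyEq, hW.ae_gibbs]

lemma integral_gibbs (hW : IsGibbsPotential D W) (g : ℝ → ℝ) :
    ∫ x, g x ∂(gibbs D W) = (∫ x, g x * Real.exp (-W x) ∂D.vol) / partition D W := by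
  have hZ := hW.partition_pos
  rw [gibbs, integral_withDensity_eq_integral_toReal_smul hW.measurable_density
    (ae_of_all _ fun x => ENNReal.ofReal_lt_top), ← integral_div]
  refine integral_congr_ae (ae_of_all _ fun x => ?_)
  simp only
  rw [ENNReal.toReal_ofReal (by positivity), smul_eq_mul]
  ring

lemma integrable_gibbs_iff (hW : IsGibbsPotential D W) :
    Integrable φ (gibbs D W) ↔ Integrable (fun x => φ x * Real.exp (-W x)) D.vol := by
  have hZ := hW.partition_pos
  rw [gibbs, integrable_withDensity_iff_integrable_smul' hW.measurable_density
    (ae_of_all _ fun x => ENNReal.ofReal_lt_top),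
    ← integrable_const_mul_iff (isUnit_iff_ne_zero.2 (inv_ne_zero hZ.ne'))
      (fun x => φ x * Real.exp (-W x))]
  refine integrable_congr (ae_of_all _ fun x => ?_)
  simp only
  rw [ENNReal.toReal_ofReal (by positivity), smul_eq_mul]
  ring

lemma memLp_gibbs_iff (hW : IsGibbsPotential D W) :
    MemLp φ 2 (gibbs D W) ↔ AEStronglyMeasurable φ D.vol ∧
      Integrable (fun x => φ x ^ 2 * Real.exp (-W x)) D.vol := by
  rw [← hW.integrable_gibbs_iff (φ := fun x => φ x ^ 2), ← hW.aestronglyMeasurable_gibbs_iff]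
  exact ⟨fun h => ⟨h.1, h.integrable_sq⟩, fun h => (memLp_two_iff_integrable_sq h.1).2 h.2⟩

lemma isProbabilityMeasure (hW : IsGibbsPotential D W) : IsProbabilityMeasure (gibbs D W) := by
  have integrable_one : Integrable (fun _ : ℝ => (1 : ℝ)) (gibbs D W) := by
    rw [hW.integrable_gibbs_iff]
    simpa using hW.integrable
  have : IsFiniteMeasure (gibbs D W) := (integrable_const_iff_isFiniteMeasure one_ne_zero).1
    integrable_one
  have integral_one := hW.integral_gibbs fun _ => 1
  simp only [integral_const, smul_eq_mul, mul_one, one_mul] at integral_one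
  rw [← partition, div_self hW.partition_pos.ne', Measure.real, ENNReal.toReal_eq_one_iff]
    at integral_one
  exact ⟨integral_one⟩

lemma locallyIntegrable (hW : IsGibbsPotential D W) (hφ : Integrable φ (gibbs D W)) :
    LocallyIntegrable φ D.vol := by
  have hexp : Continuous fun x => Real.exp (W x) := Real.continuous_exp.comp hW.continuous
  convert (hW.integrable_gibbs_iff.1 hφ).locallyIntegrable.continuous_mul hexp using 2 with x
  rw [mul_left_comm, exp_mul_exp_neg, mul_one]

lemma locallyIntegrable_of_memLp (hW : IsGibbsPotential D W) (hφ : MemLp φ 2 (gibbs D W)) :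
    LocallyIntegrable φ D.vol := by
  have := hW.isProbabilityMeasure
  exact hW.locallyIntegrable (hφ.integrable one_le_two)

lemma add_of_abs_le (hV : IsGibbsPotential D V) (hU : Continuous U) (hC : ∀ x, |U x| ≤ C) :
    IsGibbsPotential D (V + U) := by
  refine ⟨hV.continuous.add hU, ?_⟩
  simp only [Pi.add_apply, neg_add, Real.exp_add]
  refine hV.integrable.mul_bdd (c := Real.exp C) (by fun_prop) (ae_of_all _ fun x => ?_)
  rw [Real.norm_of_nonneg (Real.exp_pos _).le]
  exact Real.exp_le_exp.2 ((neg_le_abs _).trans (hC x))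

lemma gibbs_add_le_smul (hV : IsGibbsPotential D V) (hU : Continuous U) (hC : ∀ x, |U x| ≤ C) :
    gibbs D (V + U) ≤ ENNReal.ofReal (Real.exp (2 * C)) • gibbs D V := by
  have hVU := hV.add_of_abs_le hU hC
  have hZ := hV.partition_pos
  have hZU := hVU.partition_pos
  have exp_add_le (x : ℝ) : Real.exp (-(V + U) x) ≤ Real.exp C * Real.exp (-V x) := by
    rw [← Real.exp_add, Pi.add_apply, Real.exp_le_exp]
    linarith [neg_le_abs (U x), hC x]
  have partition_le : partition D V ≤ Real.exp C * partition D (V + U) := by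
    rw [partition, partition, ← integral_const_mul]
    refine integral_mono hV.integrable (hVU.integrable.const_mul _) fun x => ?_
    simp only
    rw [← Real.exp_add, Pi.add_apply, Real.exp_le_exp]
    linarith [le_abs_self (U x), hC x]
  rw [gibbs, gibbs, ← withDensity_smul _ hV.measurable_density]
  refine withDensity_mono (ae_of_all _ fun x => ?_)
  simp only [Pi.smul_apply, smul_eq_mul]
  rw [← ENNReal.ofReal_mul (Real.exp_pos _).le]
  refine ENNReal.ofReal_le_ofReal ?_
  rw [← mul_div_assoc, div_le_div_iff₀ hZU hZ]
  calc _ ≤ Real.exp C * Real.exp (-V x) * (Real.exp C * partition D (V + U)) := by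
        gcongr
        exact exp_add_le x
    _ = _ := by rw [two_mul, Real.exp_add]; ring

lemma gibbs_le_smul_add (hV : IsGibbsPotential D V) (hU : Continuous U) (hC : ∀ x, |U x| ≤ C) :
    gibbs D V ≤ ENNReal.ofReal (Real.exp (2 * C)) • gibbs D (V + U) := by
  simpa using (hV.add_of_abs_le hU hC).gibbs_add_le_smul hU.neg fun x => by simpa using hC x

end IsGibbsPotential

lemma IsWeakDeriv.sub (hφl : LocallyIntegrable φ D.vol) (hφl' : LocallyIntegrable φ' D.vol)
    (hψl : LocallyIntegrable ψ D.vol) (hψl' : LocallyIntegrable ψ' D.vol)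
    (hφ : IsWeakDeriv D φ φ') (hψ : IsWeakDeriv D ψ ψ') :
    IsWeakDeriv D (fun x => φ x - ψ x) fun x => φ' x - ψ' x := by
  intro η hη
  simp only [sub_mul]
  rw [integral_sub (Dom.integrable_mul_smoothCompact hφl hη.deriv)
      (Dom.integrable_mul_smoothCompact hψl hη.deriv),
    integral_sub (Dom.integrable_mul_smoothCompact hφl' hη)
      (Dom.integrable_mul_smoothCompact hψl' hη), hφ η hη, hψ η hη]
  ring

lemma isWeakDeriv_const (D : Dom) (c : ℝ) : IsWeakDeriv D (fun _ => c) fun _ => 0 := fun _ hη =>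
  Dom.integral_mul_deriv_smoothCompact (fun x => hasDerivAt_const x c) continuous_const
    (Dom.smooth_iff.1 (Dom.Smooth.const c)).2 hη

lemma IsGibbsPotential.memH1Zero_sub_mean (hW : IsGibbsPotential D W)
    (hφ : MemLp φ 2 (gibbs D W)) (hφ' : MemLp φ' 2 (gibbs D W)) (h : IsWeakDeriv D φ φ') :
    MemH1Zero D (gibbs D W) (fun x => φ x - mean D W φ) φ' := by
  have := hW.isProbabilityMeasure
  refine ⟨hφ.sub (memLp_const _), ?_, hφ', ?_⟩
  · rw [integral_sub (hφ.integrable one_le_two) (integrable_const _)]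
    simp [mean]
  · simpa using h.sub (hW.locallyIntegrable_of_memLp hφ) (hW.locallyIntegrable_of_memLp hφ')
      (locallyIntegrable_const _) (locallyIntegrable_const _) (isWeakDeriv_const D _)

lemma poincare_gibbs_iff (hW : IsGibbsPotential D W) : Poincare D (gibbs D W) ↔
    ∃ c, 0 < c ∧ ∀ φ φ' : ℝ → ℝ, MemLp φ 2 (gibbs D W) → MemLp φ' 2 (gibbs D W) →
      IsWeakDeriv D φ φ' → Var[φ; gibbs D W] ≤ c * ∫ x, φ' x ^ 2 ∂(gibbs D W) := by
  constructor
  · rintro ⟨R, hR, hP⟩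
    refine ⟨1 / R, by positivity, fun φ φ' hφ hφ' hd => ?_⟩
    rw [variance_eq_integral hφ.1.aemeasurable]
    exact hP _ _ (hW.memH1Zero_sub_mean hφ hφ' hd)
  · rintro ⟨c, hc, hP⟩
    refine ⟨1 / c, by positivity, fun φ φ' hφ => ?_⟩
    rw [one_div_one_div, ← variance_of_integral_eq_zero hφ.memLp.1.aemeasurable hφ.mean_zero]
    exact hP φ φ' hφ.memLp hφ.memLp_deriv hφ.weakDeriv

/-- The Holley–Stroock perturbation principle. -/
lemma Poincare.add_of_abs_le (hV : IsGibbsPotential D V) (hU : Continuous U)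
    (hC : ∀ x, |U x| ≤ C) (hP : Poincare D (gibbs D V)) : Poincare D (gibbs D (V + U)) := by
  obtain ⟨c, hc, hP⟩ := (poincare_gibbs_iff hV).1 hP
  have hVU := hV.add_of_abs_le hU hC
  have := hV.isProbabilityMeasure
  have := hVU.isProbabilityMeasure
  have hle := hV.gibbs_add_le_smul hU hC
  have hge := hV.gibbs_le_smul_add hU hC
  set M := Real.exp (2 * C)
  have hM : 0 < M := Real.exp_pos _
  refine (poincare_gibbs_iff hVU).2 ⟨M * (c * M), by positivity, fun φ φ' hφ hφ' hd => ?_⟩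
  have hφV := hφ.of_measure_le_smul ENNReal.ofReal_ne_top hge
  have hφV' := hφ'.of_measure_le_smul ENNReal.ofReal_ne_top hge
  calc Var[φ; gibbs D (V + U)] ≤ M * Var[φ; gibbs D V] := variance_le_mul_of_le_smul hM.le hle hφV
    _ ≤ M * (c * ∫ x, φ' x ^ 2 ∂(gibbs D V)) := by gcongr; exact hP φ φ' hφV hφV' hd
    _ ≤ M * (c * (M * ∫ x, φ' x ^ 2 ∂(gibbs D (V + U)))) := by
        gcongr
        exact integral_le_mul_of_le_smul hM.le hge (fun _ => sq_nonneg _) hφ'.integrable_sq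
    _ = M * (c * M) * ∫ x, φ' x ^ 2 ∂(gibbs D (V + U)) := by ring

lemma locallyLipschitz_neg_deriv (hW : ContDiff ℝ ∞ W) : LocallyLipschitz fun x => -deriv W x := by
  have h : ContDiff ℝ ∞ fun x => -deriv W x := (contDiff_infty_iff_deriv.1 hW).2.neg
  exact (h.of_le (by simp)).locallyLipschitz

lemma StronglyWellPosed.add_smoothCompact (hV : D.Smooth V) (hU : D.SmoothCompact U)
    (hwp : StronglyWellPosed fun x => -deriv V x) :
    StronglyWellPosed fun x => -deriv (V + U) x := by
  have hVc := (Dom.smooth_iff.1 hV).1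
  have hVUl := locallyLipschitz_neg_deriv (hVc.add hU.contDiff)
  cases D
  · obtain ⟨K, hK⟩ := hU.2.isCompact.isBounded.subset_closedBall 0
    refine hwp.of_eq_off_compact (K := K + 1) (locallyLipschitz_neg_deriv hVc) hVUl fun z hz => ?_
    have deriv_U : deriv U z = 0 := image_eq_zero_of_notMem_tsupport fun h => by
      have := mem_closedBall_zero_iff.1 (hK (tsupport_deriv_subset h))
      rw [Real.norm_eq_abs] at this
      linarith
    rw [deriv_add (hVc.differentiable (by simp) z) (hU.hasDerivAt z).differentiableAt, deriv_U,
      add_zero]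
  · have hVU : Dom.torus.SmoothCompact (V + U) := Dom.SmoothCompact.add (D := .torus) hV hU
    obtain ⟨C, hC⟩ := hVU.deriv.exists_abs_le
    exact stronglyWellPosed_of_bounded hVUl fun z => by rw [abs_neg]; exact hC z

lemma MemU0.isGibbsPotential (hV : D.Smooth V) (h : MemU0 D V f U) : IsGibbsPotential D (V + U) :=
  ⟨(Dom.smooth_iff.1 hV).1.continuous.add (Dom.smooth_iff.1 h.smooth).1.continuous, h.integrable⟩

lemma Dom.SmoothCompact.memU0 (hU : D.SmoothCompact U) (hV : D.Smooth V) (h0 : MemU0 D V f 0) :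
    MemU0 D V f U := by
  obtain ⟨C, hC⟩ := hU.exists_abs_le
  have hU₀ := hU.continuous
  have hVG : IsGibbsPotential D V := by simpa using h0.isGibbsPotential hV
  refine ⟨hU.smooth, (hVG.add_of_abs_le hU₀ hC).integrable,
    Poincare.add_of_abs_le hVG hU₀ hC (by simpa using h0.poincare), ?_,
    .add_smoothCompact hV hU (by simpa using h0.wellPosed)⟩
  have memLp_V : MemLp (fun x => f x - mean D V f) 2 (gibbs D V) := by simpa using h0.memLp
  have memLp_VU := memLp_V.of_measure_le_smul ENNReal.ofReal_ne_top (hVG.gibbs_add_le_smul hU₀ hC)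
  refine MemLp.mul' (memLp_top_of_bound (by fun_prop) (Real.exp C) (ae_of_all _ fun x => ?_))
    memLp_VU
  rw [Real.norm_of_nonneg (Real.exp_pos _).le]
  exact Real.exp_le_exp.2 ((le_abs_self _).trans (hC x))

end Gibbs

section Integration

variable {α : Type*} [MeasurableSpace α] {μ : Measure α} {a b w : α → ℝ}

lemma sq_integral_mul_le (ha : MemLp a 2 μ) (hb : MemLp b 2 μ) :
    (∫ x, a x * b x ∂μ) ^ 2 ≤ (∫ x, a x ^ 2 ∂μ) * ∫ x, b x ^ 2 ∂μ := by
  have hab : Integrable (fun x => a x * b x) μ := ha.integrable_mul hb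
  have hquad (t : ℝ) : Integrable (fun x => t * t * a x ^ 2 + 2 * t * (a x * b x)) μ :=
    (ha.integrable_sq.const_mul _).add (hab.const_mul _)
  have quadratic_nonneg (t : ℝ) :
      0 ≤ (∫ x, a x ^ 2 ∂μ) * (t * t) + (2 * ∫ x, a x * b x ∂μ) * t + ∫ x, b x ^ 2 ∂μ := by
    calc 0 ≤ ∫ x, (t * a x + b x) ^ 2 ∂μ := integral_nonneg fun x => sq_nonneg _
      _ = ∫ x, (t * t * a x ^ 2 + 2 * t * (a x * b x) + b x ^ 2) ∂μ := by
          congr 1 with x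
          ring
      _ = t * t * (∫ x, a x ^ 2 ∂μ) + 2 * t * (∫ x, a x * b x ∂μ) + ∫ x, b x ^ 2 ∂μ := by
          rw [integral_add (hquad t) hb.integrable_sq,
            integral_add (ha.integrable_sq.const_mul _) (hab.const_mul _), integral_const_mul,
            integral_const_mul]
      _ = _ := by ring
  have := discrim_le_zero quadratic_nonneg
  rw [discrim] at this
  linarith

lemma sq_mul_exp_half (a w : ℝ) : (a * Real.exp (w / 2)) ^ 2 = a ^ 2 * Real.exp w := by
  rw [mul_pow, ← Real.exp_nat_mul]
  congr 2
  push_cast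
  ring

lemma memLp_mul_exp_half (hw : AEStronglyMeasurable w μ) (ha : AEStronglyMeasurable a μ)
    (ha2 : Integrable (fun x => a x ^ 2 * Real.exp (w x)) μ) :
    MemLp (fun x => a x * Real.exp (w x / 2)) 2 μ := by
  have hexp : AEStronglyMeasurable (fun x => Real.exp (w x / 2)) μ :=
    (by fun_prop : Continuous fun y => Real.exp (y / 2)).comp_aestronglyMeasurable hw
  exact (memLp_two_iff_integrable_sq (ha.mul hexp)).2 (by simpa [sq_mul_exp_half] using ha2)

lemma mul_exp_half_mul_exp_neg_half (a b w : ℝ) :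
    a * Real.exp (w / 2) * (b * Real.exp (-w / 2)) = a * b := by
  rw [mul_mul_mul_comm, neg_div, exp_mul_exp_neg, mul_one]

lemma integrable_mul_of_weighted (hw : AEStronglyMeasurable w μ) (ha : AEStronglyMeasurable a μ)
    (hb : AEStronglyMeasurable b μ) (ha2 : Integrable (fun x => a x ^ 2 * Real.exp (w x)) μ)
    (hb2 : Integrable (fun x => b x ^ 2 * Real.exp (-w x)) μ) :
    Integrable (fun x => a x * b x) μ := by
  simpa only [Pi.mul_def, Pi.neg_apply, mul_exp_half_mul_exp_neg_half] using
    (memLp_mul_exp_half hw ha ha2).integrable_mul (memLp_mul_exp_half hw.neg hb hb2)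

lemma sq_integral_mul_le_weighted (hw : AEStronglyMeasurable w μ) (ha : AEStronglyMeasurable a μ)
    (hb : AEStronglyMeasurable b μ) (ha2 : Integrable (fun x => a x ^ 2 * Real.exp (w x)) μ)
    (hb2 : Integrable (fun x => b x ^ 2 * Real.exp (-w x)) μ) :
    (∫ x, a x * b x ∂μ) ^ 2 ≤
      (∫ x, a x ^ 2 * Real.exp (w x) ∂μ) * ∫ x, b x ^ 2 * Real.exp (-w x) ∂μ := by
  simpa only [Pi.neg_apply, sq_mul_exp_half, mul_exp_half_mul_exp_neg_half] using
    sq_integral_mul_le (memLp_mul_exp_half hw ha ha2) (memLp_mul_exp_half hw.neg hb hb2)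

lemma integrable_of_tendsto_of_integral_le {u : ℕ → α → ℝ} {g : α → ℝ} {C : ℝ}
    (hu0 : ∀ n x, 0 ≤ u n x) (hu : ∀ n, Integrable (u n) μ) (hC : ∀ n, ∫ x, u n x ∂μ ≤ C)
    (hlim : ∀ x, Tendsto (fun n => u n x) atTop (𝓝 (g x))) : Integrable g μ := by
  have lintegral_le (n : ℕ) : ∫⁻ x, ‖u n x‖ₑ ∂μ ≤ ENNReal.ofReal C := by
    rw [← ofReal_integral_norm_eq_lintegral_enorm (hu n)]
    simp only [Real.norm_of_nonneg (hu0 n _)]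
    exact ENNReal.ofReal_le_ofReal (hC n)
  refine ⟨aestronglyMeasurable_of_tendsto_ae atTop (fun n => (hu n).1) (ae_of_all _ hlim), ?_⟩
  calc ∫⁻ x, ‖g x‖ₑ ∂μ = ∫⁻ x, liminf (fun n => ‖u n x‖ₑ) atTop ∂μ :=
        lintegral_congr fun x => (hlim x).enorm.liminf_eq.symm
    _ ≤ liminf (fun n => ∫⁻ x, ‖u n x‖ₑ ∂μ) atTop := lintegral_liminf_le' fun n => (hu n).1.enorm
    _ ≤ ENNReal.ofReal C := liminf_le_of_frequently_le' (.of_forall lintegral_le)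
    _ < ⊤ := ENNReal.ofReal_lt_top

lemma integral_sq_sub_prod [IsProbabilityMeasure μ] (ha : MemLp a 2 μ) :
    ∫ p, (a p.1 - a p.2) ^ 2 ∂(μ.prod μ) = 2 * Var[a; μ] := by
  have hfst : MemLp (fun p : α × α => a p.1) 2 (μ.prod μ) := ha.comp_fst μ
  have hsnd : MemLp (fun p : α × α => a p.2) 2 (μ.prod μ) := ha.comp_snd μ
  have hsub : MemLp (fun p : α × α => a p.1 + (-a) p.2) 2 (μ.prod μ) := hfst.add hsnd.neg
  have mean_zero : ∫ p, (a p.1 + (-a) p.2) ∂(μ.prod μ) = 0 := by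
    simp only [Pi.neg_apply, ← sub_eq_add_neg]
    rw [integral_sub (hfst.integrable one_le_two) (hsnd.integrable one_le_two), integral_fun_fst,
      integral_fun_snd, sub_self]
  have variance_prod := variance_add_prod ha ha.neg
  rw [variance_of_integral_eq_zero hsub.1.aemeasurable mean_zero, variance_neg]
    at variance_prod
  simpa [← sub_eq_add_neg, two_mul] using variance_prod

/-- Fatou's lemma is applied to `(a x - a y) ^ 2` on the product space: a bound on the variances
gives no control on the means. -/
lemma memLp_two_of_tendsto_of_variance_le [IsProbabilityMeasure μ] {u : ℕ → α → ℝ} {C : ℝ}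
    (hu : ∀ n, MemLp (u n) 2 μ) (hC : ∀ n, Var[u n; μ] ≤ C)
    (hlim : ∀ x, Tendsto (fun n => u n x) atTop (𝓝 (a x))) : MemLp a 2 μ := by
  have memLp_sub (n : ℕ) : MemLp (fun p : α × α => u n p.1 - u n p.2) 2 (μ.prod μ) :=
    ((hu n).comp_fst μ).sub ((hu n).comp_snd μ)
  have hsub : Integrable (fun p : α × α => (a p.1 - a p.2) ^ 2) (μ.prod μ) :=
    integrable_of_tendsto_of_integral_le (u := fun n p => (u n p.1 - u n p.2) ^ 2)
      (C := 2 * C) (fun _ _ => sq_nonneg _)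
      (fun n => (memLp_sub n).integrable_sq)
      (fun n => (integral_sq_sub_prod (hu n)).trans_le (by linarith [hC n]))
      fun p => ((hlim p.1).sub (hlim p.2)).pow 2
  have ha : AEStronglyMeasurable a μ :=
    aestronglyMeasurable_of_tendsto_ae atTop (fun n => (hu n).1) (ae_of_all _ hlim)
  obtain ⟨x, hx⟩ := hsub.prod_right_ae.exists
  have : MemLp (fun y => a x - a y) 2 μ :=
    (memLp_two_iff_integrable_sq (aestronglyMeasurable_const.sub ha)).2 hx
  have : MemLp (fun y => a x - (a x - a y)) 2 μ := (memLp_const (a x)).sub this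
  simpa only [sub_sub_cancel] using this

end Integration

section Poincare

variable {D : Dom} {W φ φ' ψ ψ' G g χ : ℝ → ℝ}

lemma tendsto_mul_sin_div (y : ℝ) :
    Tendsto (fun n : ℕ => (n + 1) * Real.sin (y / (n + 1))) atTop (𝓝 y) := by
  have hderiv : HasDerivAt (fun t => Real.sin (t * y)) y 0 := by
    simpa using ((hasDerivAt_id (0 : ℝ)).mul_const y).sin
  have hinv : Tendsto (fun n : ℕ => 1 / ((n : ℝ) + 1)) atTop (𝓝[>] 0) :=
    tendsto_nhdsWithin_iff.2 ⟨tendsto_one_div_add_atTop_nhds_zero_nat,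
      .of_forall fun n => by simp only [mem_Ioi]; positivity⟩
  simpa [Function.comp_def, div_eq_inv_mul] using hderiv.tendsto_slope_zero_right.comp hinv

/-- The bounded functions `k sin (φ / k)` have derivatives no larger than that of `φ`, and their
variances are controlled by the Poincaré inequality. -/
lemma Poincare.memLp_of_hasDerivAt (hW : IsGibbsPotential D W) (hP : Poincare D (gibbs D W))
    (hφ : ∀ x, HasDerivAt φ (φ' x) x) (hφc : Continuous φ') (hper : D.Per φ)
    (hφ' : MemLp φ' 2 (gibbs D W)) : MemLp φ 2 (gibbs D W) := by
  have := hW.isProbabilityMeasure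
  obtain ⟨c, hc, hP⟩ := (poincare_gibbs_iff hW).1 hP
  have hφ₀ : Continuous φ := continuous_iff_continuousAt.2 fun x => (hφ x).continuousAt
  have hψ (n : ℕ) (x : ℝ) : HasDerivAt (fun x => (n + 1) * Real.sin (φ x / (n + 1)))
      (Real.cos (φ x / (n + 1)) * φ' x) x := by
    refine (((hφ x).div_const (n + 1 : ℝ)).sin.const_mul (n + 1 : ℝ)).congr_deriv ?_
    field_simp
  have hψ' (n : ℕ) : Continuous fun x => Real.cos (φ x / (n + 1)) * φ' x := by fun_prop
  have memLp_ψ (n : ℕ) : MemLp (fun x => (n + 1) * Real.sin (φ x / (n + 1))) 2 (gibbs D W) := by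
    refine .of_bound (by fun_prop) (n + 1) (ae_of_all _ fun x => ?_)
    rw [norm_mul, Real.norm_of_nonneg (by positivity)]
    exact mul_le_of_le_one_right (by positivity) (Real.abs_sin_le_one _)
  have norm_le (n : ℕ) (x : ℝ) : ‖Real.cos (φ x / (n + 1)) * φ' x‖ ≤ ‖φ' x‖ := by
    rw [norm_mul]
    exact mul_le_of_le_one_left (norm_nonneg _) (Real.abs_cos_le_one _)
  have memLp_ψ' (n : ℕ) : MemLp (fun x => Real.cos (φ x / (n + 1)) * φ' x) 2 (gibbs D W) :=
    hφ'.mono (hψ' n).aestronglyMeasurable (ae_of_all _ (norm_le n))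
  refine memLp_two_of_tendsto_of_variance_le memLp_ψ (C := c * ∫ x, φ' x ^ 2 ∂(gibbs D W))
    (fun n => ?_) fun x => tendsto_mul_sin_div (φ x)
  refine (hP _ _ (memLp_ψ n) (memLp_ψ' n) fun η hη =>
    Dom.integral_mul_deriv_smoothCompact (hψ n) (hψ' n)
      (hper.comp fun y => (n + 1) * Real.sin (y / (n + 1))) hη).trans ?_
  gcongr c * ?_
  exact integral_mono (memLp_ψ' n).integrable_sq hφ'.integrable_sq fun x => sq_le_sq.2 (norm_le n x)

/-- Under a Poincaré inequality a mean-zero `g ∈ L²(e^W)` acts continuously on the homogeneous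
Sobolev space. -/
lemma Poincare.exists_sq_integral_mul_le (hW : IsGibbsPotential D W) (hP : Poincare D (gibbs D W))
    (hg : Continuous g) (hg0 : ∫ x, g x ∂D.vol = 0)
    (hg2 : Integrable (fun x => g x ^ 2 * Real.exp (W x)) D.vol) :
    ∃ c, ∀ φ φ' : ℝ → ℝ, MemLp φ 2 (gibbs D W) → MemLp φ' 2 (gibbs D W) → IsWeakDeriv D φ φ' →
      (∫ x, g x * φ x ∂D.vol) ^ 2 ≤ c * ∫ x, φ' x ^ 2 * Real.exp (-W x) ∂D.vol := by
  obtain ⟨c, -, hP⟩ := (poincare_gibbs_iff hW).1 hP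
  have hWm := hW.continuous.aestronglyMeasurable (μ := D.vol)
  have hgm := hg.aestronglyMeasurable (μ := D.vol)
  have hgi : Integrable g D.vol := by
    simpa using integrable_mul_of_weighted hWm hgm (aestronglyMeasurable_const (b := (1 : ℝ))) hg2
      (by simpa using hW.integrable)
  refine ⟨(∫ x, g x ^ 2 * Real.exp (W x) ∂D.vol) * c, fun φ φ' hφ hφ' hd => ?_⟩
  have centered := (hW.memH1Zero_sub_mean hφ hφ' hd).memLp
  obtain ⟨hφm, hφ2⟩ := hW.memLp_gibbs_iff.1 hφ
  obtain ⟨hcm, hc2⟩ := hW.memLp_gibbs_iff.1 centered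
  have variance_le : ∫ x, (φ x - mean D W φ) ^ 2 * Real.exp (-W x) ∂D.vol ≤
      c * ∫ x, φ' x ^ 2 * Real.exp (-W x) ∂D.vol := by
    have : ∫ x, (φ x - mean D W φ) ^ 2 ∂(gibbs D W) ≤ c * ∫ x, φ' x ^ 2 ∂(gibbs D W) :=
      (variance_eq_integral hφ.1.aemeasurable).symm.trans_le (hP φ φ' hφ hφ' hd)
    rwa [hW.integral_gibbs fun x => (φ x - mean D W φ) ^ 2, hW.integral_gibbs fun x => φ' x ^ 2,
      ← mul_div_assoc, div_le_div_iff_of_pos_right hW.partition_pos] at this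
  calc (∫ x, g x * φ x ∂D.vol) ^ 2 = (∫ x, g x * (φ x - mean D W φ) ∂D.vol) ^ 2 := by
        simp only [mul_sub]
        rw [integral_sub (integrable_mul_of_weighted hWm hgm hφm hg2 hφ2) (hgi.mul_const _),
          integral_mul_const, hg0, zero_mul, sub_zero]
    _ ≤ _ := sq_integral_mul_le_weighted hWm hgm hcm hg2 hc2
    _ ≤ (∫ x, g x ^ 2 * Real.exp (W x) ∂D.vol) *
          (c * ∫ x, φ' x ^ 2 * Real.exp (-W x) ∂D.vol) := by
        gcongr
    _ = _ := (mul_assoc _ _ _).symm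

lemma abs_primitive_le {u : ℝ → ℝ} (hu : Integrable u) (x : ℝ) :
    |∫ y in (0 : ℝ)..x, u y| ≤ ∫ y, |u y| :=
  (intervalIntegral.norm_integral_le_integral_norm_uIoc).trans
    (setIntegral_le_integral hu.norm (ae_of_all _ fun _ => norm_nonneg _))

lemma integral_mul_deriv_of_tendsto_zero {C : ℝ} (hψ : ∀ x, HasDerivAt ψ (ψ' x) x)
    (hC : ∀ x, |ψ x| ≤ C) (hG : ∀ x, HasDerivAt G (g x) x) (hg : Integrable g)
    (hψ'G : Integrable fun x => ψ' x * G x)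
    (hbot : Tendsto G atBot (𝓝 0)) (htop : Tendsto G atTop (𝓝 0)) :
    ∫ x, ψ x * g x = -∫ x, ψ' x * G x := by
  have hψc : Continuous ψ := continuous_iff_continuousAt.2 fun x => (hψ x).continuousAt
  have tendsto_mul {l : Filter ℝ} (hl : Tendsto G l (𝓝 0)) : Tendsto (ψ * G) l (𝓝 0) :=
    bdd_le_mul_tendsto_zero' C (.of_forall hC) hl
  simpa using integral_mul_deriv_eq_deriv_mul (fun x _ => hψ x) (fun x _ => hG x)
    (hg.bdd_mul hψc.aestronglyMeasurable (ae_of_all _ hC)) hψ'G (tendsto_mul hbot)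
    (tendsto_mul htop)

/-- The test function is a primitive of `G e^W χ`. -/
lemma sq_integral_flux_sq_mul_le {c : ℝ} (hW : IsGibbsPotential .line W)
    (hP : ∀ φ φ' : ℝ → ℝ, MemLp φ 2 (gibbs .line W) → MemLp φ' 2 (gibbs .line W) →
      IsWeakDeriv .line φ φ' →
      (∫ x, g x * φ x) ^ 2 ≤ c * ∫ x, φ' x ^ 2 * Real.exp (-W x))
    (hG : ∀ x, HasDerivAt G (g x) x) (hg : Integrable g)
    (hbot : Tendsto G atBot (𝓝 0)) (htop : Tendsto G atTop (𝓝 0))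
    (hχ : Dom.line.SmoothCompact χ) :
    (∫ x, G x ^ 2 * Real.exp (W x) * χ x) ^ 2 ≤
      c * ∫ x, G x ^ 2 * Real.exp (W x) * χ x * χ x := by
  have := hW.isProbabilityMeasure
  have hGc : Continuous G := continuous_iff_continuousAt.2 fun x => (hG x).continuousAt
  have hWc := hW.continuous
  have hχc := hχ.continuous
  have integrable_mul_χ {u : ℝ → ℝ} (hu : Continuous u) : Integrable fun x => u x * χ x :=
    Dom.integrable_mul_smoothCompact (D := .line) hu.locallyIntegrable hχ
  set ψ' : ℝ → ℝ := fun x => G x * Real.exp (W x) * χ x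
  have hψ'c : Continuous ψ' := by fun_prop
  have hψ (x : ℝ) : HasDerivAt (fun x => ∫ y in (0 : ℝ)..x, ψ' y) (ψ' x) x :=
    hψ'c.integral_hasStrictDerivAt 0 x |>.hasDerivAt
  have hψb := abs_primitive_le (integrable_mul_χ (u := fun x => G x * Real.exp (W x)) (by fun_prop))
  have hψc := continuous_iff_continuousAt.2 fun x => (hψ x).continuousAt
  have ψ'_mul_G (x : ℝ) : ψ' x * G x = G x ^ 2 * Real.exp (W x) * χ x := by
    simp only [ψ']
    ring
  have ψ'_sq (x : ℝ) : ψ' x ^ 2 * Real.exp (-W x) = G x ^ 2 * Real.exp (W x) * χ x * χ x := by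
    simp only [ψ']
    linear_combination (G x ^ 2 * Real.exp (W x) * χ x ^ 2) * exp_mul_exp_neg (W x)
  have memLp_ψ' : MemLp ψ' 2 (gibbs .line W) := hW.memLp_gibbs_iff.2
    ⟨hψ'c.aestronglyMeasurable, by simp only [ψ'_sq]; exact integrable_mul_χ (by fun_prop)⟩
  have ibp := integral_mul_deriv_of_tendsto_zero hψ hψb hG hg
    (by simpa only [ψ'_mul_G] using integrable_mul_χ (by fun_prop)) hbot htop
  have duality := hP _ ψ' (.of_bound hψc.aestronglyMeasurable _ (ae_of_all _ hψb)) memLp_ψ'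
    fun η hη => Dom.integral_mul_deriv_smoothCompact hψ hψ'c trivial hη
  simp only [mul_comm (g _)] at duality
  simpa only [ibp, neg_sq, ψ'_mul_G, ψ'_sq] using duality

lemma Poincare.integrable_flux_sq (hW : IsGibbsPotential .line W)
    (hP : Poincare .line (gibbs .line W)) (hG : ∀ x, HasDerivAt G (g x) x) (hgc : Continuous g)
    (hg : Integrable g) (hg0 : ∫ x, g x = 0) (hg2 : Integrable fun x => g x ^ 2 * Real.exp (W x))
    (hbot : Tendsto G atBot (𝓝 0)) (htop : Tendsto G atTop (𝓝 0)) :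
    Integrable fun x => G x ^ 2 * Real.exp (W x) := by
  obtain ⟨c, hP⟩ := hP.exists_sq_integral_mul_le hW hgc hg0 hg2
  obtain ⟨χ, hχ, hχ01, hχ1⟩ := Dom.exists_cutoff .line
  have hWc := hW.continuous
  have hGc : Continuous G := continuous_iff_continuousAt.2 fun x => (hG x).continuousAt
  have hu : LocallyIntegrable (fun x => G x ^ 2 * Real.exp (W x)) :=
    Continuous.locallyIntegrable (by fun_prop)
  have cutoff_nonneg (n : ℕ) (x : ℝ) : 0 ≤ G x ^ 2 * Real.exp (W x) * χ n x :=
    mul_nonneg (by positivity) (hχ01 n x).1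
  have cutoff_integrable (n : ℕ) : Integrable fun x => G x ^ 2 * Real.exp (W x) * χ n x :=
    Dom.integrable_mul_smoothCompact (D := .line) hu (hχ n)
  refine integrable_of_tendsto_of_integral_le (C := max c 0) cutoff_nonneg cutoff_integrable
    (fun n => ?_) fun x => ?_
  · set J := ∫ x, G x ^ 2 * Real.exp (W x) * χ n x
    have J_nonneg : 0 ≤ J := integral_nonneg (cutoff_nonneg n)
    have le_J : ∫ x, G x ^ 2 * Real.exp (W x) * χ n x * χ n x ≤ J :=
      integral_mono
        (Dom.integrable_mul_smoothCompact (D := .line) (cutoff_integrable n).locallyIntegrable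
          (hχ n))
        (cutoff_integrable n)
        fun x => mul_le_of_le_one_right (cutoff_nonneg n x) (hχ01 n x).2
    have J_sq_le : J ^ 2 ≤ max c 0 * J :=
      (sq_integral_flux_sq_mul_le hW hP hG hg hbot htop (hχ n)).trans
        (mul_le_mul (le_max_left _ _) le_J
          (integral_nonneg fun x => mul_nonneg (cutoff_nonneg n x) (hχ01 n x).1) (le_max_right _ _))
    rcases J_nonneg.eq_or_lt with hJ | hJ
    · exact hJ ▸ le_max_right _ _
    · exact le_of_mul_le_mul_right (by rwa [← sq]) hJ
  · refine tendsto_const_nhds.congr' ?_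
    filter_upwards [eventually_ge_atTop ⌈|x|⌉₊] with n hn
    rw [hχ1 n x (Nat.ceil_le.1 hn), mul_one]

end Poincare

section DuBoisReymond

variable {D : Dom} {u ζ : ℝ → ℝ}

lemma Dom.exists_smoothCompact_deriv_eq (hζ : D.SmoothCompact ζ) (h0 : ∫ x, ζ x ∂D.vol = 0) :
    ∃ η, D.SmoothCompact η ∧ deriv η = ζ := by
  have hderiv (a : ℝ) : deriv (fun x => ∫ y in a..x, ζ y) = ζ :=
    funext (hζ.continuous.deriv_integral ζ a)
  cases D
  swap
  · exact ⟨_, ⟨contDiff_primitive hζ.contDiff 0,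
      Per.primitive (D := .torus) hζ.continuous hζ.2 fun _ => h0⟩, hderiv 0⟩
  obtain ⟨K, hK⟩ := hζ.2.isCompact.isBounded.subset_closedBall 0
  have eq_zero_of_lt (x : ℝ) (hx : K < |x|) : ζ x = 0 := image_eq_zero_of_notMem_tsupport fun h =>
    hx.not_ge (by simpa using hK h)
  have hζi : Integrable ζ := hζ.1.continuous.integrable_of_hasCompactSupport hζ.2
  have integral_Iic_eq (x : ℝ) : ∫ y in Iic x, ζ y = ∫ y in -(|K| + 1)..x, ζ y := by
    rw [← intervalIntegral.integral_Iic_sub_Iic hζi.integrableOn hζi.integrableOn, eq_comm,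
      sub_eq_self]
    refine setIntegral_eq_zero_of_forall_eq_zero fun y hy => eq_zero_of_lt y (lt_abs.2 (.inr ?_))
    linarith [mem_Iic.1 hy, le_abs_self K]
  refine ⟨_, ⟨contDiff_primitive hζ.contDiff (-(|K| + 1)),
    .intro (isCompact_closedBall 0 K) fun x hx => ?_⟩, hderiv _⟩
  rw [mem_closedBall_zero_iff, Real.norm_eq_abs, not_le] at hx
  rw [← integral_Iic_eq]
  rcases lt_abs.1 hx with hKx | hKx
  · rw [setIntegral_eq_integral_of_forall_compl_eq_zero, ← h0, vol]
    exact fun y hy => eq_zero_of_lt y (lt_abs.2 (.inl (hKx.trans (not_le.1 hy))))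
  · exact setIntegral_eq_zero_of_forall_eq_zero fun y hy =>
      eq_zero_of_lt y (lt_abs.2 (.inr (hKx.trans_le (neg_le_neg hy))))

lemma Dom.exists_smoothCompact_integral_eq_one (D : Dom) :
    ∃ ζ, D.SmoothCompact ζ ∧ ∫ x, ζ x ∂D.vol = 1 := by
  by_contra! hne
  have integral_eq_zero (ζ : ℝ → ℝ) (hζ : D.SmoothCompact ζ) : ∫ x, 1 * ζ x ∂D.vol = 0 := by
    simp only [one_mul]
    by_contra h0
    refine hne _ (hζ.mul_left (Smooth.const (∫ x, ζ x ∂D.vol)⁻¹)) ?_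
    rw [integral_const_mul, inv_mul_cancel₀ h0]
  obtain ⟨_, hx⟩ :=
    (ae_eq_zero_of_integral_mul_smoothCompact (locallyIntegrable_const 1) integral_eq_zero).exists
  exact one_ne_zero hx

lemma Dom.ae_eq_const_of_integral_mul_deriv_eq_zero (hu : LocallyIntegrable u D.vol)
    (h : ∀ η, D.SmoothCompact η → ∫ x, u x * deriv η x ∂D.vol = 0) :
    ∃ c, u =ᵐ[D.vol] fun _ => c := by
  obtain ⟨ζ₀, hζ₀, hζ₀1⟩ := exists_smoothCompact_integral_eq_one D
  have integrable_test {ζ : ℝ → ℝ} (hζ : D.SmoothCompact ζ) : Integrable ζ D.vol := by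
    simpa using integrable_mul_smoothCompact (locallyIntegrable_const 1) hζ
  set c := ∫ x, u x * ζ₀ x ∂D.vol
  have hsub : (fun x => u x - c) =ᵐ[D.vol] 0 := by
    refine ae_eq_zero_of_integral_mul_smoothCompact (hu.sub (locallyIntegrable_const c))
      fun ζ hζ => ?_
    set a := ∫ x, ζ x ∂D.vol
    have hcorr := hζ₀.mul_left (Smooth.const (-a))
    obtain ⟨η, hη, hderiv⟩ := exists_smoothCompact_deriv_eq (hζ.add hcorr) (by
      rw [integral_add (integrable_test hζ) (integrable_test hcorr), integral_const_mul, hζ₀1]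
      ring)
    have orthogonal := h η hη
    simp only [hderiv, mul_add, mul_left_comm _ (-a)] at orthogonal
    rw [integral_add (integrable_mul_smoothCompact hu hζ)
      ((integrable_mul_smoothCompact hu hζ₀).const_mul _), integral_const_mul] at orthogonal
    simp only [sub_mul]
    rw [integral_sub (integrable_mul_smoothCompact hu hζ) ((integrable_test hζ).const_mul _),
      integral_const_mul]
    linarith
  exact ⟨c, hsub.mono fun x hx => sub_eq_zero.1 hx⟩

end DuBoisReymond

section PoissonEquation

variable {D : Dom} {V W f U φ φ' ψ ψ' η : ℝ → ℝ} {c : ℝ}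

lemma generator_mul_exp_neg (hW : ContDiff ℝ ∞ W) (hη : ContDiff ℝ ∞ η) (x : ℝ) :
    generator W η x * Real.exp (-W x) = deriv (fun x => Real.exp (-W x) * deriv η x) x := by
  have hWd : HasDerivAt W (deriv W x) x := (hW.differentiable (by simp) x).hasDerivAt
  have hηd : HasDerivAt (deriv η) (deriv (deriv η) x) x :=
    ((contDiff_infty_iff_deriv.1 hη).2.differentiable (by simp) x).hasDerivAt
  rw [(hWd.fun_neg.exp.fun_mul hηd).deriv, generator]
  ring

lemma IsWeakDeriv.integral_mul_generator (h : IsWeakDeriv D φ φ') (hW : D.Smooth W)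
    (hη : D.SmoothCompact η) :
    ∫ x, φ x * -generator W η x * Real.exp (-W x) ∂D.vol =
      ∫ x, φ' x * Real.exp (-W x) * deriv η x ∂D.vol := by
  obtain ⟨hWc, hWper⟩ := Dom.smooth_iff.1 hW
  have smooth_exp : D.Smooth fun x => Real.exp (-W x) :=
    Dom.smooth_iff.2 ⟨hWc.neg.exp, hWper.comp fun y => Real.exp (-y)⟩
  have weak := h _ (hη.deriv.mul_left smooth_exp)
  simp only [mul_assoc, neg_mul, mul_neg, generator_mul_exp_neg hWc hη.contDiff, integral_neg]
  rw [weak, neg_neg]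

lemma MemH1Zero.sub (hW : IsGibbsPotential D W) (hφ : MemH1Zero D (gibbs D W) φ φ')
    (hψ : MemH1Zero D (gibbs D W) ψ ψ') :
    MemH1Zero D (gibbs D W) (fun x => φ x - ψ x) fun x => φ' x - ψ' x := by
  have := hW.isProbabilityMeasure
  refine ⟨hφ.memLp.sub hψ.memLp, ?_, hφ.memLp_deriv.sub hψ.memLp_deriv,
    hφ.weakDeriv.sub (hW.locallyIntegrable_of_memLp hφ.memLp)
      (hW.locallyIntegrable_of_memLp hφ.memLp_deriv) (hW.locallyIntegrable_of_memLp hψ.memLp)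
      (hW.locallyIntegrable_of_memLp hψ.memLp_deriv) hψ.weakDeriv⟩
  rw [integral_sub (hφ.memLp.integrable one_le_two) (hψ.memLp.integrable one_le_two),
    hφ.mean_zero, hψ.mean_zero, sub_zero]

lemma Poincare.ae_eq_zero (hP : Poincare D (gibbs D W)) (hW : IsGibbsPotential D W)
    (hφ : MemH1Zero D (gibbs D W) φ φ') (h : φ' =ᵐ[D.vol] 0) : φ =ᵐ[D.vol] 0 := by
  obtain ⟨R, -, hP⟩ := hP
  rw [← hW.ae_gibbs] at h ⊢
  have deriv_sq : ∫ x, φ' x ^ 2 ∂(gibbs D W) = 0 :=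
    integral_eq_zero_of_ae (h.mono fun x hx => by simp [hx])
  have integral_sq_le := hP φ φ' hφ
  rw [deriv_sq, mul_zero] at integral_sq_le
  have sq_eq_zero := (integral_eq_zero_iff_of_nonneg (fun x => sq_nonneg (φ x))
    hφ.memLp.integrable_sq).1 (integral_sq_le.antisymm (integral_nonneg fun x => sq_nonneg _))
  exact sq_eq_zero.mono fun x hx => pow_eq_zero_iff two_ne_zero |>.1 hx

lemma IsGibbsPotential.not_integrable_exp (hW : IsGibbsPotential .line W) :
    ¬Integrable fun x => Real.exp (W x) := by
  intro h
  have integrable_one : Integrable (fun _ : ℝ => (1 : ℝ)) := by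
    refine (h.add hW.integrable).mono' (by fun_prop) (ae_of_all _ fun x => ?_)
    simp only [Pi.add_apply, norm_one]
    linarith [Real.add_one_le_exp (W x), Real.add_one_le_exp (-W x)]
  have := (integrable_const_iff_isFiniteMeasure one_ne_zero).1 integrable_one
  exact (measure_lt_top volume (univ : Set ℝ)).ne Real.volume_univ

/-- On the line `e^W` is not in `L²(e^{-W})`; on the torus a derivative has mean zero. -/
lemma MemH1Zero.eq_zero_of_deriv_ae_eq (hW : IsGibbsPotential D W)
    (hφ : MemH1Zero D (gibbs D W) φ φ') (h : ∀ᵐ x ∂D.vol, φ' x = c * Real.exp (W x)) : c = 0 := by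
  have hWc := hW.continuous
  cases D
  · by_contra hc
    have hsq := (hW.memLp_gibbs_iff.1 hφ.memLp_deriv).2
    have : Integrable (fun x => c ^ 2 * Real.exp (W x)) Dom.line.vol := hsq.congr <| h.mono
      fun x hx => by
        simp only [hx]
        linear_combination c ^ 2 * Real.exp (W x) * exp_mul_exp_neg (W x)
    exact hW.not_integrable_exp
      ((integrable_const_mul_iff (isUnit_iff_ne_zero.2 (pow_ne_zero 2 hc)) _).1 this)
  · have mean_deriv := hφ.weakDeriv _ (Dom.Smooth.const (D := .torus) 1)
    simp only [deriv_const, mul_zero, integral_zero, mul_one, zero_eq_neg] at mean_deriv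
    have hexp : Integrable (fun x => Real.exp (W x)) Dom.torus.vol :=
      Dom.integrable_torus (Continuous.locallyIntegrable (by fun_prop))
    rw [integral_congr_ae h, integral_const_mul, mul_eq_zero] at mean_deriv
    exact mean_deriv.resolve_right (integral_exp_pos hexp).ne'

/-- The density `(f - I) e^{-V}`, whose primitive is `primF`. It is the right-hand side of the
Poisson equation in divergence form, `-(e^{-(V+U)} φ_U')' = (f - I) e^{-V}`. -/
noncomputable def source (D : Dom) (V f : ℝ → ℝ) (x : ℝ) : ℝ :=
  (f x - mean D V f) * Real.exp (-V x)

lemma isPoissonSolution_iff (hW : IsGibbsPotential D (V + U)) (hWs : D.Smooth (V + U)) :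
    IsPoissonSolution D V f U φ φ' ↔ MemH1Zero D (gibbs D (V + U)) φ φ' ∧
      ∀ η, D.SmoothCompact η → ∫ x, φ' x * Real.exp (-(V + U) x) * deriv η x ∂D.vol =
        ∫ x, source D V f x * η x ∂D.vol := by
  have hsource (η : ℝ → ℝ) (x : ℝ) :
      (f x - mean D V f) * Real.exp (U x) * η x * Real.exp (-(V + U) x) = source D V f x * η x := by
    rw [source, Pi.add_apply, neg_add, Real.exp_add]
    linear_combination ((f x - mean D V f) * η x * Real.exp (-V x)) * exp_mul_exp_neg (U x)
  have equation_iff (hφ : MemH1Zero D (gibbs D (V + U)) φ φ') (η : ℝ → ℝ)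
      (hη : D.SmoothCompact η) :
      ∫ x, φ x * -generator (V + U) η x ∂(gibbs D (V + U)) =
        ∫ x, (f x - mean D V f) * Real.exp (U x) * η x ∂(gibbs D (V + U)) ↔
      ∫ x, φ' x * Real.exp (-(V + U) x) * deriv η x ∂D.vol = ∫ x, source D V f x * η x ∂D.vol := by
    rw [hW.integral_gibbs, hW.integral_gibbs, div_left_inj' hW.partition_pos.ne',
      hφ.weakDeriv.integral_mul_generator hWs hη]
    simp only [hsource]
  exact ⟨fun h => ⟨h.memH1Zero, fun η hη => (equation_iff h.memH1Zero η hη).1 (h.equation η hη)⟩,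
    fun h => ⟨h.1, fun η hη => (equation_iff h.1 η hη).2 (h.2 η hη)⟩⟩

lemma IsPoissonSolution.deriv_ae_eq (hW : IsGibbsPotential D (V + U)) (hWs : D.Smooth (V + U))
    (hφ : IsPoissonSolution D V f U φ φ') (hψ : IsPoissonSolution D V f U ψ ψ') :
    ψ' =ᵐ[D.vol] φ' := by
  have := hW.isProbabilityMeasure
  rw [isPoissonSolution_iff hW hWs] at hφ hψ
  have hsub := hψ.1.sub hW hφ.1
  have integrable_mul_exp {φ φ' : ℝ → ℝ} (h : MemH1Zero D (gibbs D (V + U)) φ φ') :=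
    (hW.integrable_gibbs_iff.1 (h.memLp_deriv.integrable one_le_two)).locallyIntegrable
  obtain ⟨c, hc⟩ := Dom.ae_eq_const_of_integral_mul_deriv_eq_zero (integrable_mul_exp hsub)
    fun η hη => by
      simp only [sub_mul]
      rw [integral_sub (Dom.integrable_mul_smoothCompact (integrable_mul_exp hψ.1) hη.deriv)
        (Dom.integrable_mul_smoothCompact (integrable_mul_exp hφ.1) hη.deriv), hψ.2 η hη,
        hφ.2 η hη, sub_self]
  have deriv_sub : ∀ᵐ x ∂D.vol, ψ' x - φ' x = c * Real.exp ((V + U) x) := hc.mono fun x hx => by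
    linear_combination
      Real.exp ((V + U) x) * hx - (ψ' x - φ' x) * exp_mul_exp_neg ((V + U) x)
  rw [hsub.eq_zero_of_deriv_ae_eq hW deriv_sub] at deriv_sub
  exact deriv_sub.mono fun x hx => by linarith

lemma IsPoissonSolution.ae_eq (hW : IsGibbsPotential D (V + U)) (hWs : D.Smooth (V + U))
    (hP : Poincare D (gibbs D (V + U))) (hφ : IsPoissonSolution D V f U φ φ')
    (hψ : IsPoissonSolution D V f U ψ ψ') : ψ =ᵐ[D.vol] φ :=
  (hP.ae_eq_zero hW (hψ.memH1Zero.sub hW hφ.memH1Zero)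
    ((hφ.deriv_ae_eq hW hWs hψ).mono fun _ hx => sub_eq_zero.2 hx)).mono
    fun _ hx => sub_eq_zero.1 hx

end PoissonEquation

section Flux

variable {D : Dom} {V f U : ℝ → ℝ}

/-- The constant `A_U` for which `φ_U' = -(F - A_U) e^{V + U}`. On the line it is dictated by the
decay of the flux at infinity, on the torus by the periodicity of `φ_U`. -/
noncomputable def fluxConst (D : Dom) (V f U : ℝ → ℝ) : ℝ :=
  match D with
  | .line => Astar .line V f
  | .torus => (∫ x, primF .torus V f x * Real.exp ((V + U) x) ∂Dom.torus.vol) /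
      ∫ x, Real.exp ((V + U) x) ∂Dom.torus.vol

/-- The flux `F - A_U = -φ_U' e^{-(V + U)}`. -/
noncomputable def flux (D : Dom) (V f U : ℝ → ℝ) (x : ℝ) : ℝ := primF D V f x - fluxConst D V f U

/-- The standing assumptions on the potential `V` and the observable `f`. -/
structure IsObservable (D : Dom) (V f : ℝ → ℝ) : Prop where
  smooth_potential : D.Smooth V
  smooth : D.Smooth f
  isGibbsPotential : IsGibbsPotential D V
  integrable : Integrable f (gibbs D V)

namespace IsObservable

lemma contDiff_source (h : IsObservable D V f) : ContDiff ℝ ∞ (source D V f) :=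
  ((Dom.smooth_iff.1 h.smooth).1.sub contDiff_const).mul
    (Dom.smooth_iff.1 h.smooth_potential).1.neg.exp

lemma per_source (h : IsObservable D V f) : D.Per (source D V f) :=
  (Dom.smooth_iff.1 h.smooth).2.comp₂ (fun a b => (a - mean D V f) * Real.exp (-b))
    (Dom.smooth_iff.1 h.smooth_potential).2

lemma integrable_source (h : IsObservable D V f) : Integrable (source D V f) D.vol := by
  have := h.isGibbsPotential.isProbabilityMeasure
  exact h.isGibbsPotential.integrable_gibbs_iff.1 (h.integrable.sub (integrable_const _))

lemma integral_source (h : IsObservable D V f) : ∫ x, source D V f x ∂D.vol = 0 := by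
  have := h.isGibbsPotential.isProbabilityMeasure
  have mean_sub := h.isGibbsPotential.integral_gibbs fun x => f x - mean D V f
  rw [integral_sub h.integrable (integrable_const _), integral_const, probReal_univ, one_smul, mean,
    sub_self, eq_comm, div_eq_zero_iff] at mean_sub
  exact mean_sub.resolve_right h.isGibbsPotential.partition_pos.ne'

lemma integrable_source_sq (h : IsObservable D V f) (hU : MemU0 D V f U) :
    Integrable (fun x => source D V f x ^ 2 * Real.exp ((V + U) x)) D.vol := by
  have hW := hU.isGibbsPotential h.smooth_potential
  refine (hW.memLp_gibbs_iff.1 hU.memLp).2.congr (ae_of_all _ fun x => ?_)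
  simp only [source, Pi.add_apply, mul_pow, ← Real.exp_nat_mul, mul_assoc, ← Real.exp_add]
  congr 2
  push_cast
  ring

lemma hasDerivAt_primF (h : IsObservable D V f) (x : ℝ) :
    HasDerivAt (primF D V f) (source D V f x) x :=
  (h.contDiff_source.continuous.integral_hasStrictDerivAt 0 x).hasDerivAt

lemma hasDerivAt_flux (h : IsObservable D V f) (x : ℝ) :
    HasDerivAt (flux D V f U) (source D V f x) x :=
  (h.hasDerivAt_primF x).sub_const _

lemma contDiff_primF (h : IsObservable D V f) : ContDiff ℝ ∞ (primF D V f) :=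
  contDiff_primitive h.contDiff_source 0

lemma per_primF (h : IsObservable D V f) : D.Per (primF D V f) :=
  h.per_source.primitive h.contDiff_source.continuous fun _ => h.integral_source

lemma continuous_flux (h : IsObservable D V f) : Continuous (flux D V f U) :=
  h.contDiff_primF.continuous.sub continuous_const

lemma per_flux (h : IsObservable D V f) : D.Per (flux D V f U) :=
  h.per_primF.comp fun a => a - fluxConst D V f U

lemma tendsto_flux_line (h : IsObservable .line V f) :
    Tendsto (flux .line V f U) atBot (𝓝 0) ∧ Tendsto (flux .line V f U) atTop (𝓝 0) := by
  have hi : Integrable (source .line V f) := h.integrable_source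
  have fluxConst_eq : fluxConst .line V f U = -∫ x in Iic 0, source .line V f x := rfl
  have flux_eq (x : ℝ) : flux .line V f U x = ∫ y in Iic x, source .line V f y := by
    rw [flux, fluxConst_eq, sub_neg_eq_add, ← eq_sub_iff_add_eq,
      intervalIntegral.integral_Iic_sub_Iic hi.integrableOn hi.integrableOn]
    rfl
  refine ⟨?_, ?_⟩
  · rw [funext flux_eq]
    exact tendsto_integral_Iic_zero tendsto_id
  · have flux_eq_neg (x : ℝ) : flux .line V f U x = -∫ y in Ioi x, source .line V f y := by
      rw [flux_eq, eq_neg_iff_add_eq_zero,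
        intervalIntegral.integral_Iic_add_Ioi hi.integrableOn hi.integrableOn]
      exact h.integral_source
    rw [funext flux_eq_neg, ← neg_zero]
    exact (tendsto_integral_Ioi_zero tendsto_id).neg

lemma integrable_flux_sq (h : IsObservable D V f) (hU : MemU0 D V f U) :
    Integrable (fun x => flux D V f U x ^ 2 * Real.exp ((V + U) x)) D.vol := by
  have hW := hU.isGibbsPotential h.smooth_potential
  have hWc := hW.continuous
  have hc := h.continuous_flux (U := U)
  cases D
  · exact Poincare.integrable_flux_sq hW hU.poincare h.hasDerivAt_flux h.contDiff_source.continuous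
      h.integrable_source h.integral_source (h.integrable_source_sq hU) h.tendsto_flux_line.1
      h.tendsto_flux_line.2
  · exact Dom.integrable_torus (Continuous.locallyIntegrable (by fun_prop))

lemma integral_flux_mul_exp_torus (h : IsObservable .torus V f) (hU : Continuous (V + U)) :
    ∫ x, flux .torus V f U x * Real.exp ((V + U) x) ∂Dom.torus.vol = 0 := by
  have hF := h.contDiff_primF.continuous
  have integrable_primF : Integrable (fun x => primF .torus V f x * Real.exp ((V + U) x))
      Dom.torus.vol := Dom.integrable_torus (Continuous.locallyIntegrable (by fun_prop))
  have integrable_exp : Integrable (fun x => Real.exp ((V + U) x)) Dom.torus.vol :=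
    Dom.integrable_torus (Continuous.locallyIntegrable (by fun_prop))
  simp only [flux, sub_mul]
  rw [integral_sub integrable_primF (integrable_exp.const_mul _), integral_const_mul, fluxConst,
    div_mul_cancel₀ _ (integral_exp_pos integrable_exp).ne', sub_self]

lemma smooth_add (h : IsObservable D V f) (hU : MemU0 D V f U) : D.Smooth (V + U) := by
  obtain ⟨hVc, hVper⟩ := Dom.smooth_iff.1 h.smooth_potential
  obtain ⟨hUc, hUper⟩ := Dom.smooth_iff.1 hU.smooth
  exact Dom.smooth_iff.2 ⟨hVc.add hUc, hVper.comp₂ (· + ·) hUper⟩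

lemma exists_isPoissonSolution (h : IsObservable D V f) (hU : MemU0 D V f U) :
    ∃ φ, IsPoissonSolution D V f U φ fun x => -(flux D V f U x * Real.exp ((V + U) x)) := by
  have hW := hU.isGibbsPotential h.smooth_potential
  have hWc := hW.continuous
  have hWs := h.smooth_add hU
  have hflux := h.continuous_flux (U := U)
  set φ' : ℝ → ℝ := fun x => -(flux D V f U x * Real.exp ((V + U) x)) with hφ'
  have hφ'c : Continuous φ' := by fun_prop
  have φ'_mul_exp (x : ℝ) : φ' x * Real.exp (-(V + U) x) = -flux D V f U x := by
    linear_combination -flux D V f U x * exp_mul_exp_neg ((V + U) x)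
  have hφ (x : ℝ) : HasDerivAt (fun x => ∫ y in (0 : ℝ)..x, φ' y) (φ' x) x :=
    (hφ'c.integral_hasStrictDerivAt 0 x).hasDerivAt
  have hper : D.Per fun x => ∫ y in (0 : ℝ)..x, φ' y :=
    (h.per_flux.comp₂ (fun a b => -(a * Real.exp b)) (Dom.smooth_iff.1 hWs).2).primitive hφ'c <| by
      rintro rfl
      simp only [φ', integral_neg, h.integral_flux_mul_exp_torus hWc, neg_zero]
  have memLp_φ' : MemLp φ' 2 (gibbs D (V + U)) := by
    refine hW.memLp_gibbs_iff.2 ⟨hφ'c.aestronglyMeasurable, (h.integrable_flux_sq hU).congr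
      (ae_of_all _ fun x => ?_)⟩
    linear_combination (-φ' x) * φ'_mul_exp x
  have memH1Zero := hW.memH1Zero_sub_mean (hU.poincare.memLp_of_hasDerivAt hW hφ hφ'c hper memLp_φ')
    memLp_φ' fun η hη => Dom.integral_mul_deriv_smoothCompact hφ hφ'c hper hη
  refine ⟨_, (isPoissonSolution_iff hW hWs).2 ⟨memH1Zero, fun η hη => ?_⟩⟩
  simp only [φ'_mul_exp, neg_mul, integral_neg]
  rw [Dom.integral_mul_deriv_smoothCompact h.hasDerivAt_flux h.contDiff_source.continuous
    h.per_flux hη, neg_neg]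

lemma asymVar_eq (h : IsObservable D V f) (hU : MemU0 D V f U) :
    asymVar D V f U = 2 / partition D V ^ 2 *
      (partition D (V + U) * ∫ x, flux D V f U x ^ 2 * Real.exp ((V + U) x) ∂D.vol) := by
  have hW := hU.isGibbsPotential h.smooth_potential
  obtain ⟨φ, hφ⟩ := h.exists_isPoissonSolution hU
  have hex : ∃ p : (ℝ → ℝ) × (ℝ → ℝ), IsPoissonSolution D V f U p.1 p.2 := ⟨(φ, _), hφ⟩
  have integral_deriv_sq : ∫ x, |hex.choose.2 x| ^ 2 * Real.exp (-(V + U) x) ∂D.vol =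
      ∫ x, flux D V f U x ^ 2 * Real.exp ((V + U) x) ∂D.vol := by
    refine integral_congr_ae ((hφ.deriv_ae_eq hW (h.smooth_add hU) hex.choose_spec).mono
      fun x hx => ?_)
    simp only [hx, sq_abs]
    linear_combination
      (flux D V f U x ^ 2 * Real.exp ((V + U) x)) * exp_mul_exp_neg ((V + U) x)
  have hZ := hW.partition_pos
  rw [asymVar, dif_pos hex, hW.integral_gibbs, integral_deriv_sq]
  field_simp

end IsObservable

end Flux

section Median

variable {α : Type*} [MeasurableSpace α] {μ : Measure α} {F : α → ℝ}

lemma abs_real_sign_le_one (r : ℝ) : |Real.sign r| ≤ 1 := by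
  rcases Real.sign_apply_eq r with h | h | h <;> norm_num [h]

lemma monotone_real_sign : Monotone Real.sign := by
  intro a b hab
  rcases lt_trichotomy a 0 with ha | rfl | ha
  · rw [Real.sign_of_neg ha]
    exact (abs_le.1 (abs_real_sign_le_one b)).1
  · rcases hab.eq_or_lt with rfl | hb
    · exact le_rfl
    · simp only [Real.sign_zero, Real.sign_of_pos hb, zero_le_one]
  · rw [Real.sign_of_pos ha, Real.sign_of_pos (ha.trans_le hab)]

lemma abs_sub_add_mul_sign_le (y A B : ℝ) :
    |y - B| + (B - A) * Real.sign (y - B) ≤ |y - A| := by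
  rcases lt_trichotomy (y - B) 0 with h | h | h
  · rw [Real.sign_of_neg h, abs_of_neg h]
    linarith [neg_abs_le (y - A)]
  · simp only [h, abs_zero, Real.sign_zero, mul_zero, add_zero, abs_nonneg]
  · rw [Real.sign_of_pos h, abs_of_pos h]
    linarith [le_abs_self (y - A)]

lemma aestronglyMeasurable_sign_sub (hF : AEStronglyMeasurable F μ) (A : ℝ) :
    AEStronglyMeasurable (fun x => Real.sign (F x - A)) μ :=
  (monotone_real_sign.measurable.comp_aemeasurable
    (hF.aemeasurable.sub_const A)).aestronglyMeasurable

variable [IsFiniteMeasure μ]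

lemma integrable_sign_sub (hF : AEStronglyMeasurable F μ) (A : ℝ) :
    Integrable (fun x => Real.sign (F x - A)) μ :=
  .of_bound (aestronglyMeasurable_sign_sub hF A) 1
    (ae_of_all _ fun _ => abs_real_sign_le_one _)

lemma antitone_integral_sign_sub (hF : AEStronglyMeasurable F μ) :
    Antitone fun A => ∫ x, Real.sign (F x - A) ∂μ := fun A B hAB =>
  integral_mono (integrable_sign_sub hF B) (integrable_sign_sub hF A) fun x =>
    monotone_real_sign (sub_le_sub_left hAB (F x))

lemma tendsto_integral_sign_sub {l : Filter ℝ} [l.IsCountablyGenerated] {s : ℝ}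
    (hF : AEStronglyMeasurable F μ) (hs : ∀ y, ∀ᶠ A in l, Real.sign (y - A) = s) :
    Tendsto (fun A => ∫ x, Real.sign (F x - A) ∂μ) l (𝓝 (μ.real univ * s)) := by
  rw [← smul_eq_mul, ← integral_const]
  exact tendsto_integral_filter_of_dominated_convergence (fun _ => 1)
    (Eventually.of_forall fun A => aestronglyMeasurable_sign_sub hF A)
    (Eventually.of_forall fun _ => ae_of_all _ fun _ => abs_real_sign_le_one _)
    (integrable_const 1) (ae_of_all _ fun x => tendsto_const_nhds.congr' ((hs (F x)).mono
      fun _ hA => hA.symm))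

lemma nonempty_setOf_integral_sign_nonneg [NeZero μ] (hF : AEStronglyMeasurable F μ) :
    {A | 0 ≤ ∫ x, Real.sign (F x - A) ∂μ}.Nonempty := by
  have lim := tendsto_integral_sign_sub (l := atBot) (s := 1) hF fun y =>
    (eventually_lt_atBot y).mono fun A hA => Real.sign_of_pos (sub_pos.2 hA)
  rw [mul_one] at lim
  exact (lim.eventually (lt_mem_nhds measureReal_univ_pos)).exists.imp fun _ hA => hA.le

lemma bddAbove_setOf_integral_sign_nonneg [NeZero μ] (hF : AEStronglyMeasurable F μ) :
    BddAbove {A | 0 ≤ ∫ x, Real.sign (F x - A) ∂μ} := by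
  have lim := tendsto_integral_sign_sub (l := atTop) (s := -1) hF fun y =>
    (eventually_gt_atTop y).mono fun A hA => Real.sign_of_neg (sub_neg.2 hA)
  rw [mul_neg_one] at lim
  obtain ⟨B, hB⟩ := (lim.eventually (gt_mem_nhds (neg_lt_zero.2 measureReal_univ_pos))).exists
  refine ⟨B, fun A hA => le_of_lt ?_⟩
  by_contra! hBA
  exact hB.not_ge (hA.trans (antitone_integral_sign_sub hF hBA))

lemma integral_abs_sub_add_mul_integral_sign_le (hF : Integrable F μ) (A B : ℝ) :
    ∫ x, |F x - B| ∂μ + (B - A) * ∫ x, Real.sign (F x - B) ∂μ ≤ ∫ x, |F x - A| ∂μ := by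
  have integrable_abs (C : ℝ) : Integrable (fun x => |F x - C|) μ :=
    (hF.sub (integrable_const C)).abs
  have integrable_sign := (integrable_sign_sub hF.1 B).const_mul (B - A)
  rw [← integral_const_mul, ← integral_add (integrable_abs B) integrable_sign]
  exact integral_mono ((integrable_abs B).add integrable_sign) (integrable_abs A)
    fun x => abs_sub_add_mul_sign_le (F x) A B

lemma continuous_integral_abs_sub (hF : Integrable F μ) :
    Continuous fun A => ∫ x, |F x - A| ∂μ := by
  refine (LipschitzWith.of_le_add_mul (μ.real univ).toNNReal fun A B => ?_).continuous
  have integrable_abs (C : ℝ) : Integrable (fun x => |F x - C|) μ :=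
    (hF.sub (integrable_const C)).abs
  rw [Real.coe_toNNReal _ measureReal_nonneg, ← smul_eq_mul, ← integral_const,
    ← integral_add (integrable_abs B) (integrable_const _)]
  refine integral_mono (integrable_abs A) ((integrable_abs B).add (integrable_const _)) fun x => ?_
  rw [dist_comm, Real.dist_eq]
  exact abs_sub_le (F x) B A

/-- The sign integral at `B` is a subgradient of `A ↦ ∫ |F - A|`, and it is nonnegative below the
median and negative above it. -/
lemma integral_abs_sub_csSup_le [NeZero μ] (hF : Integrable F μ) (A : ℝ) :
    ∫ x, |F x - sSup {A : ℝ | 0 ≤ ∫ x, Real.sign (F x - A) ∂μ}| ∂μ ≤ ∫ x, |F x - A| ∂μ := by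
  set M := sSup {A : ℝ | 0 ≤ ∫ x, Real.sign (F x - A) ∂μ}
  have subgradient := integral_abs_sub_add_mul_integral_sign_le hF A
  have tendsto_M := (continuous_integral_abs_sub hF).tendsto M
  rcases lt_trichotomy A M with hA | rfl | hA
  · refine le_of_tendsto (tendsto_M.mono_left (nhdsWithin_le_nhds (s := Iio M))) ?_
    filter_upwards [Ioo_mem_nhdsLT hA] with B hB
    obtain ⟨A', hA', hBA'⟩ :=
      exists_lt_of_lt_csSup (nonempty_setOf_integral_sign_nonneg hF.1) hB.2
    have sign_nonneg := hA'.trans (antitone_integral_sign_sub hF.1 hBA'.le)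
    linarith [subgradient B, mul_nonneg (sub_nonneg.2 hB.1.le) sign_nonneg]
  · exact le_rfl
  · refine le_of_tendsto (tendsto_M.mono_left (nhdsWithin_le_nhds (s := Ioi M))) ?_
    filter_upwards [Ioo_mem_nhdsGT hA] with B hB
    have sign_neg : ∫ x, Real.sign (F x - B) ∂μ < 0 := not_le.1 fun hB' =>
      hB.1.not_ge (le_csSup (bddAbove_setOf_integral_sign_nonneg hF.1) hB')
    linarith [subgradient B, mul_nonneg_of_nonpos_of_nonpos (sub_nonpos.2 hB.2.le) sign_neg.le]

end Median

section LowerBound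

/-- The flux `F - A*` of the optimal bias. -/
noncomputable def starFlux (D : Dom) (V f : ℝ → ℝ) (x : ℝ) : ℝ := primF D V f x - Astar D V f

instance : IsFiniteMeasure Dom.torus.vol := by
  unfold Dom.vol
  infer_instance

namespace IsObservable

variable {D : Dom} {V f U : ℝ → ℝ}

lemma contDiff_starFlux (h : IsObservable D V f) : ContDiff ℝ ∞ (starFlux D V f) :=
  h.contDiff_primF.sub contDiff_const

lemma per_starFlux (h : IsObservable D V f) : D.Per (starFlux D V f) :=
  h.per_primF.comp fun a => a - Astar D V f

lemma integrable_starFlux_sq (h : IsObservable D V f) (hU : MemU0 D V f U) :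
    Integrable (fun x => starFlux D V f x ^ 2 * Real.exp ((V + U) x)) D.vol := by
  cases D
  · exact h.integrable_flux_sq hU
  · have hW := (hU.isGibbsPotential h.smooth_potential).continuous
    have hG := h.contDiff_starFlux.continuous
    exact Dom.integrable_torus (Continuous.locallyIntegrable (by fun_prop))

lemma integrable_starFlux (h : IsObservable D V f) (hU : MemU0 D V f U) :
    Integrable (starFlux D V f) D.vol := by
  have hW := hU.isGibbsPotential h.smooth_potential
  simpa only [mul_one] using integrable_mul_of_weighted (b := fun _ => 1)
    hW.continuous.aestronglyMeasurable h.contDiff_starFlux.continuous.aestronglyMeasurable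
    aestronglyMeasurable_const (h.integrable_starFlux_sq hU)
    (by simpa only [one_pow, one_mul] using hW.integrable)

lemma integral_abs_starFlux_le (h : IsObservable D V f) :
    ∫ x, |starFlux D V f x| ∂D.vol ≤ ∫ x, |flux D V f U x| ∂D.vol := by
  cases D
  · exact le_rfl
  · exact integral_abs_sub_csSup_le
      (Dom.integrable_torus h.contDiff_primF.continuous.locallyIntegrable) _

/-- On the torus, `A_U` is the orthogonal projection of `F` on the constants in `L²(e^{V + U})`. -/
lemma integral_flux_sq_le (h : IsObservable D V f) (hU : MemU0 D V f U) :
    ∫ x, flux D V f U x ^ 2 * Real.exp ((V + U) x) ∂D.vol ≤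
      ∫ x, starFlux D V f x ^ 2 * Real.exp ((V + U) x) ∂D.vol := by
  cases D
  · exact le_rfl
  have hW := (hU.isGibbsPotential h.smooth_potential).continuous
  have hG := h.continuous_flux (U := U)
  set c := fluxConst .torus V f U - Astar .torus V f
  have integrable_cross : Integrable
      (fun x => 2 * c * (flux .torus V f U x * Real.exp ((V + U) x))) Dom.torus.vol :=
    Dom.integrable_torus (Continuous.locallyIntegrable (by fun_prop))
  have integral_cross :
      ∫ x, 2 * c * (flux .torus V f U x * Real.exp ((V + U) x)) ∂Dom.torus.vol = 0 := by
    rw [integral_const_mul, h.integral_flux_mul_exp_torus hW, mul_zero]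
  rw [← add_zero (∫ x, flux .torus V f U x ^ 2 * Real.exp ((V + U) x) ∂Dom.torus.vol),
    ← integral_cross, ← integral_add (h.integrable_flux_sq hU) integrable_cross]
  refine integral_mono ((h.integrable_flux_sq hU).add integrable_cross)
    (h.integrable_starFlux_sq hU) fun x => ?_
  have starFlux_eq : starFlux .torus V f x = flux .torus V f U x + c := by
    simp only [starFlux, flux, c]
    ring
  simp only [starFlux_eq]
  linear_combination mul_nonneg (sq_nonneg c) (Real.exp_pos ((V + U) x)).le

lemma sigmaStar_le_asymVar (h : IsObservable D V f) (hU : MemU0 D V f U) :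
    sigmaStar D V f ≤ asymVar D V f U := by
  have hW := hU.isGibbsPotential h.smooth_potential
  have cauchy_schwarz := sq_integral_mul_le_weighted (a := fun x => |flux D V f U x|)
    (b := fun _ => 1) hW.continuous.aestronglyMeasurable
    h.continuous_flux.abs.aestronglyMeasurable aestronglyMeasurable_const
    (by simpa only [sq_abs] using h.integrable_flux_sq hU)
    (by simpa only [one_pow, one_mul] using hW.integrable)
  simp only [sq_abs, mul_one, one_pow, one_mul] at cauchy_schwarz
  rw [h.asymVar_eq hU, sigmaStar, mul_comm (partition D (V + U))]
  gcongr
  exact (pow_le_pow_left₀ (integral_nonneg fun _ => abs_nonneg _) h.integral_abs_starFlux_le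
    2).trans cauchy_schwarz

end IsObservable

end LowerBound

section OptimalBias

variable {D : Dom} {V G χ : ℝ → ℝ} {δ : ℝ}

/-- A positive smooth density interpolating between a regularization `√(G² + δ²)` of the optimal
density `|G|`, where the cutoff `χ` equals `1`, and the unbiased density `e^{-V}`, where it
vanishes. -/
noncomputable def bridge (V G χ : ℝ → ℝ) (δ x : ℝ) : ℝ :=
  χ x * √(G x ^ 2 + δ ^ 2) + (1 - χ x) * Real.exp (-V x)

/-- The bias `U` with `e^{-(V + U)} = bridge V G χ δ`. -/
noncomputable def bridgeBias (V G χ : ℝ → ℝ) (δ x : ℝ) : ℝ := -Real.log (bridge V G χ δ x) - V x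

lemma sq_add_sq_pos_of_pos_right (a : ℝ) {b : ℝ} (hb : 0 < b) : 0 < a ^ 2 + b ^ 2 := by positivity

lemma inv_convex_combination_le {a b t : ℝ} (ha : 0 < a) (hb : 0 < b) (ht : t ∈ Icc (0 : ℝ) 1) :
    (t * a + (1 - t) * b)⁻¹ ≤ t * a⁻¹ + (1 - t) * b⁻¹ := by
  simpa only [zpow_neg_one, smul_eq_mul] using
    (convexOn_zpow (-1)).2 ha hb ht.1 (sub_nonneg.2 ht.2) (add_sub_cancel t 1)

lemma bridge_pos (hδ : 0 < δ) {x : ℝ} (hχ : χ x ∈ Icc 0 1) : 0 < bridge V G χ δ x :=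
  (convex_Ioi (0 : ℝ)) (Real.sqrt_pos.2 (sq_add_sq_pos_of_pos_right (G x) hδ))
    (Real.exp_pos (-V x)) hχ.1 (sub_nonneg.2 hχ.2) (add_sub_cancel (χ x) 1)

lemma exp_neg_add_bridgeBias (hδ : 0 < δ) {x : ℝ} (hχ : χ x ∈ Icc 0 1) :
    Real.exp (-(V + bridgeBias V G χ δ) x) = bridge V G χ δ x := by
  rw [Pi.add_apply, bridgeBias, add_sub_cancel, neg_neg, Real.exp_log (bridge_pos hδ hχ)]

lemma bridge_le (hδ : 0 < δ) {x : ℝ} (hχ : χ x ∈ Icc 0 1) :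
    bridge V G χ δ x ≤ |G x| + δ * χ x + (1 - χ x) * Real.exp (-V x) := by
  have sqrt_le : √(G x ^ 2 + δ ^ 2) ≤ |G x| + δ := by
    refine Real.sqrt_le_iff.2 ⟨by positivity, ?_⟩
    linear_combination 2 * mul_nonneg (abs_nonneg (G x)) hδ.le - sq_abs (G x)
  have χ_mul_sqrt_le : χ x * √(G x ^ 2 + δ ^ 2) ≤ |G x| + δ * χ x := by
    linear_combination mul_le_mul_of_nonneg_left sqrt_le hχ.1 +
      mul_le_of_le_one_left (abs_nonneg (G x)) hχ.2
  exact add_le_add_left χ_mul_sqrt_le _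

lemma sq_mul_inv_bridge_le (hδ : 0 < δ) {x : ℝ} (hχ : χ x ∈ Icc 0 1) :
    G x ^ 2 * (bridge V G χ δ x)⁻¹ ≤ |G x| + (1 - χ x) * (G x ^ 2 * Real.exp (V x)) := by
  have sqrt_pos := Real.sqrt_pos.2 (sq_add_sq_pos_of_pos_right (G x) hδ)
  have sq_mul_inv_sqrt_le : G x ^ 2 * (√(G x ^ 2 + δ ^ 2))⁻¹ ≤ |G x| := by
    rw [← div_eq_mul_inv, div_le_iff₀ sqrt_pos, ← sq_abs, sq]
    gcongr
    exact Real.abs_le_sqrt (by rw [abs_mul_abs_self, ← sq]; linarith [sq_nonneg δ])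
  have inv_le := inv_convex_combination_le sqrt_pos (Real.exp_pos (-V x)) hχ
  rw [← Real.exp_neg, neg_neg] at inv_le
  calc G x ^ 2 * (bridge V G χ δ x)⁻¹
      ≤ G x ^ 2 * (χ x * (√(G x ^ 2 + δ ^ 2))⁻¹ + (1 - χ x) * Real.exp (V x)) := by
        gcongr
        exact inv_le
    _ = χ x * (G x ^ 2 * (√(G x ^ 2 + δ ^ 2))⁻¹) + (1 - χ x) * (G x ^ 2 * Real.exp (V x)) := by
        ring
    _ ≤ _ := by
        gcongr
        exact (mul_le_of_le_one_left (by positivity) hχ.2).trans sq_mul_inv_sqrt_le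

lemma smoothCompact_bridgeBias (hV : D.Smooth V) (hG : ContDiff ℝ ∞ G) (hGper : D.Per G)
    (hδ : 0 < δ) (hχ : D.SmoothCompact χ) (hχ01 : ∀ x, χ x ∈ Icc 0 1) :
    D.SmoothCompact (bridgeBias V G χ δ) := by
  obtain ⟨hVc, hVper⟩ := Dom.smooth_iff.1 hV
  obtain ⟨hχc, hχper⟩ := Dom.smooth_iff.1 hχ.smooth
  have contDiff_sqrt : ContDiff ℝ ∞ fun x => √(G x ^ 2 + δ ^ 2) :=
    ((hG.pow 2).add contDiff_const).sqrt fun x => (sq_add_sq_pos_of_pos_right (G x) hδ).ne'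
  have contDiff_bridge : ContDiff ℝ ∞ (bridge V G χ δ) :=
    (hχc.mul contDiff_sqrt).add ((contDiff_const.sub hχc).mul hVc.neg.exp)
  have contDiff_bias : ContDiff ℝ ∞ (bridgeBias V G χ δ) :=
    (contDiff_bridge.log fun x => (bridge_pos hδ (hχ01 x)).ne').neg.sub hVc
  have per_bias : D.Per (bridgeBias V G χ δ) :=
    ((hχper.comp₂ (fun a b => a * √(b ^ 2 + δ ^ 2)) hGper).comp₂ (· + ·)
      (hχper.comp₂ (fun a b => (1 - a) * Real.exp (-b)) hVper)).comp₂
        (fun a b => -Real.log a - b) hVper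
  cases D
  · refine ⟨contDiff_bias, hχ.2.mono fun x hx => ?_⟩
    contrapose! hx
    rw [Function.notMem_support] at hx ⊢
    rw [bridgeBias, bridge, hx, zero_mul, zero_add, sub_zero, one_mul, Real.log_exp, neg_neg,
      sub_self]
  · exact ⟨contDiff_bias, per_bias⟩

section Cutoff

variable {α : Type*} [MeasurableSpace α] {μ : Measure α} {k : α → ℝ}

lemma norm_one_sub_mul_le {t : ℝ} (ht : t ∈ Icc (0 : ℝ) 1) (a : ℝ) : ‖(1 - t) * a‖ ≤ ‖a‖ := by
  rw [norm_mul, Real.norm_eq_abs, abs_of_nonneg (sub_nonneg.2 ht.2)]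
  exact mul_le_of_le_one_left (norm_nonneg _) (sub_le_self _ ht.1)

lemma integrable_one_sub_mul {χ : α → ℝ} (hk : Integrable k μ) (hχ : AEStronglyMeasurable χ μ)
    (hχ01 : ∀ x, χ x ∈ Icc 0 1) : Integrable (fun x => (1 - χ x) * k x) μ :=
  hk.mono ((aestronglyMeasurable_const.sub hχ).mul hk.1)
    (ae_of_all _ fun x => norm_one_sub_mul_le (hχ01 x) (k x))

lemma tendsto_integral_one_sub_mul {χ : ℕ → α → ℝ} (hk : Integrable k μ)
    (hχ : ∀ n, AEStronglyMeasurable (χ n) μ) (hχ01 : ∀ n x, χ n x ∈ Icc 0 1)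
    (hχ1 : ∀ x, ∀ᶠ n in atTop, χ n x = 1) :
    Tendsto (fun n => ∫ x, (1 - χ n x) * k x ∂μ) atTop (𝓝 0) := by
  rw [← integral_zero α ℝ (μ := μ)]
  refine tendsto_integral_of_dominated_convergence (fun x => ‖k x‖)
    (fun n => (aestronglyMeasurable_const.sub (hχ n)).mul hk.1) hk.norm
    (fun n => ae_of_all _ fun x => norm_one_sub_mul_le (hχ01 n x) (k x))
    (ae_of_all _ fun x => tendsto_const_nhds.congr' ((hχ1 x).mono fun n hn => ?_))
  simp only [hn, sub_self, zero_mul]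

end Cutoff

lemma partition_add_bridgeBias_le (hV : IsGibbsPotential D V) (hG : Integrable G D.vol)
    (hδ : 0 < δ) (hχ : D.SmoothCompact χ) (hχ01 : ∀ x, χ x ∈ Icc 0 1) :
    partition D (V + bridgeBias V G χ δ) ≤ ∫ x, |G x| ∂D.vol + δ * ∫ x, χ x ∂D.vol +
      ∫ x, (1 - χ x) * Real.exp (-V x) ∂D.vol := by
  have integrable_χ : Integrable χ D.vol := by
    simpa only [one_mul] using Dom.integrable_mul_smoothCompact
      (u := fun _ => 1) continuous_const.locallyIntegrable hχ
  have integrable_core : Integrable (fun x => |G x| + δ * χ x) D.vol :=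
    hG.abs.add (integrable_χ.const_mul δ)
  have integrable_tail :=
    integrable_one_sub_mul hV.integrable hχ.continuous.aestronglyMeasurable hχ01
  rw [← integral_const_mul, ← integral_add hG.abs (integrable_χ.const_mul δ),
    ← integral_add integrable_core integrable_tail]
  refine integral_mono_of_nonneg (ae_of_all _ fun x => (Real.exp_pos _).le)
    (integrable_core.add integrable_tail) (ae_of_all _ fun x => ?_)
  simp only [exp_neg_add_bridgeBias hδ (hχ01 x)]
  exact bridge_le hδ (hχ01 x)

lemma integral_sq_mul_exp_bridgeBias_le (hG : Integrable G D.vol)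
    (hG2 : Integrable (fun x => G x ^ 2 * Real.exp (V x)) D.vol)
    (hδ : 0 < δ) (hχ : D.SmoothCompact χ) (hχ01 : ∀ x, χ x ∈ Icc 0 1) :
    ∫ x, G x ^ 2 * Real.exp ((V + bridgeBias V G χ δ) x) ∂D.vol ≤
      ∫ x, |G x| ∂D.vol + ∫ x, (1 - χ x) * (G x ^ 2 * Real.exp (V x)) ∂D.vol := by
  have integrable_tail := integrable_one_sub_mul hG2 hχ.continuous.aestronglyMeasurable hχ01
  rw [← integral_add hG.abs integrable_tail]
  refine integral_mono_of_nonneg (ae_of_all _ fun x => by positivity)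
    (hG.abs.add integrable_tail) (ae_of_all _ fun x => ?_)
  simp only
  rw [← neg_neg ((V + bridgeBias V G χ δ) x), Real.exp_neg, exp_neg_add_bridgeBias hδ (hχ01 x)]
  exact sq_mul_inv_bridge_le hδ (hχ01 x)

/-- As the cutoff exhausts the space, both factors are close to `∫ |G|`. -/
lemma exists_smoothCompact_partition_mul_le (hVs : D.Smooth V) (hV : IsGibbsPotential D V)
    (hGc : ContDiff ℝ ∞ G) (hGper : D.Per G) (hG : Integrable G D.vol)
    (hG2 : Integrable (fun x => G x ^ 2 * Real.exp (V x)) D.vol) {b : ℝ}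
    (hb : (∫ x, |G x| ∂D.vol) ^ 2 < b) :
    ∃ U, D.SmoothCompact U ∧
      partition D (V + U) * ∫ x, G x ^ 2 * Real.exp ((V + U) x) ∂D.vol ≤ b := by
  obtain ⟨χ, hχ, hχ01, hχ1⟩ := D.exists_cutoff
  have hχm (n : ℕ) : AEStronglyMeasurable (χ n) D.vol := (hχ n).continuous.aestronglyMeasurable
  have eventually_one (x : ℝ) : ∀ᶠ n in atTop, χ n x = 1 :=
    (tendsto_natCast_atTop_atTop.eventually_ge_atTop |x|).mono fun n => hχ1 n x
  set a := ∫ x, |G x| ∂D.vol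
  set tailZ : ℕ → ℝ := fun n => ∫ x, (1 - χ n x) * Real.exp (-V x) ∂D.vol
  set tailG : ℕ → ℝ := fun n => ∫ x, (1 - χ n x) * (G x ^ 2 * Real.exp (V x)) ∂D.vol
  have tendsto_tails : Tendsto (fun n => (a + tailZ n) * (a + tailG n)) atTop (𝓝 (a ^ 2)) := by
    simpa only [add_zero, ← sq] using
      ((tendsto_integral_one_sub_mul hV.integrable hχm hχ01 eventually_one).const_add a).mul
        ((tendsto_integral_one_sub_mul hG2 hχm hχ01 eventually_one).const_add a)
  obtain ⟨n, hn⟩ := (tendsto_tails.eventually (gt_mem_nhds hb)).exists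
  have tendsto_reg : Tendsto (fun δ => (a + δ * ∫ x, χ n x ∂D.vol + tailZ n) * (a + tailG n))
      (𝓝[>] 0) (𝓝 ((a + tailZ n) * (a + tailG n))) :=
    (Continuous.tendsto' (by fun_prop) _ _ (by ring)).mono_left nhdsWithin_le_nhds
  obtain ⟨δ, hδb, hδ⟩ :=
    ((tendsto_reg.eventually (gt_mem_nhds hn)).and self_mem_nhdsWithin).exists
  have partition_le := partition_add_bridgeBias_le hV hG hδ (hχ n) (hχ01 n)
  refine ⟨bridgeBias V G (χ n) δ, smoothCompact_bridgeBias hVs hGc hGper hδ (hχ n) (hχ01 n),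
    le_trans ?_ hδb.le⟩
  exact mul_le_mul partition_le (integral_sq_mul_exp_bridgeBias_le hG hG2 hδ (hχ n) (hχ01 n))
    (integral_nonneg fun x => by positivity)
    ((integral_nonneg fun x => (Real.exp_pos _).le).trans partition_le)

lemma IsObservable.isGLB_asymVar {f : ℝ → ℝ} {s : Set (ℝ → ℝ)} (h : IsObservable D V f)
    (hs : ∀ U ∈ s, MemU0 D V f U) (hc : ∀ U, D.SmoothCompact U → U ∈ s) :
    IsGLB (asymVar D V f '' s) (sigmaStar D V f) := by
  have hZ := h.isGibbsPotential.partition_pos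
  have h0 := hs 0 (hc 0 Dom.SmoothCompact.zero)
  refine ⟨?_, fun b hb => le_of_forall_gt_imp_ge_of_dense fun c hcσ => ?_⟩
  · rintro _ ⟨U, hU, rfl⟩
    exact h.sigmaStar_le_asymVar (hs U hU)
  rw [sigmaStar, ← lt_div_iff₀' (by positivity)] at hcσ
  obtain ⟨U, hU, hUc⟩ := exists_smoothCompact_partition_mul_le h.smooth_potential
    h.isGibbsPotential h.contDiff_starFlux h.per_starFlux (h.integrable_starFlux h0)
    (by simpa only [add_zero] using h.integrable_starFlux_sq h0) hcσ
  have hU0 := hs U (hc U hU)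
  have hZU := (hU0.isGibbsPotential h.smooth_potential).partition_pos
  calc b ≤ asymVar D V f U := hb ⟨U, hc U hU, rfl⟩
    _ ≤ 2 / partition D V ^ 2 * (partition D (V + U) *
          ∫ x, starFlux D V f x ^ 2 * Real.exp ((V + U) x) ∂D.vol) := by
        rw [h.asymVar_eq hU0]
        exact mul_le_mul_of_nonneg_left
          (mul_le_mul_of_nonneg_left (h.integral_flux_sq_le hU0) hZU.le) (by positivity)
    _ ≤ c := (le_div_iff₀' (by positivity)).1 hUc

end OptimalBias

end BiasedLangevin

theorem mainTheorem1 (D : BiasedLangevin.Dom) (V f : ℝ → ℝ)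
    (hV : D.Smooth V)
    (hVint : Integrable (fun x => Real.exp (-V x)) D.vol)
    (hf : D.Smooth f)
    (hfint : Integrable f (BiasedLangevin.gibbs D V))
    (hfconst : ¬ ∃ c : ℝ, ∀ᵐ x ∂(BiasedLangevin.gibbs D V), f x = c)
    (h0 : BiasedLangevin.MemU0 D V f 0) :
    -- smooth compactly supported biasing potentials are nice
    (∀ U : ℝ → ℝ, D.SmoothCompact U → BiasedLangevin.MemU0 D V f U) ∧
    -- the asymptotic variance of a nice potential is well defined
    (∀ U : ℝ → ℝ, BiasedLangevin.MemU0 D V f U →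
      ∃ φ φ' : ℝ → ℝ, BiasedLangevin.IsPoissonSolution D V f U φ φ' ∧
        ∀ ψ ψ' : ℝ → ℝ, BiasedLangevin.IsPoissonSolution D V f U ψ ψ' →
          ψ =ᵐ[D.vol] φ ∧ ψ' =ᵐ[D.vol] φ') ∧
    -- the optimal value is well defined
    Integrable (fun x => BiasedLangevin.primF D V f x - BiasedLangevin.Astar D V f) D.vol ∧
    -- it is the infimum over nice potentials
    IsGLB (BiasedLangevin.asymVar D V f '' {U | BiasedLangevin.MemU0 D V f U})
      (BiasedLangevin.sigmaStar D V f) ∧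
    -- it is also the infimum over smooth compactly supported potentials
    IsGLB (BiasedLangevin.asymVar D V f '' {U | D.SmoothCompact U})
      (BiasedLangevin.sigmaStar D V f) := by
  have hVG : BiasedLangevin.IsGibbsPotential D V := by simpa using h0.isGibbsPotential hV
  have h : BiasedLangevin.IsObservable D V f := ⟨hV, hf, hVG, hfint⟩
  have memU0 (U : ℝ → ℝ) (hU : D.SmoothCompact U) : BiasedLangevin.MemU0 D V f U :=
    hU.memU0 hV h0
  refine ⟨memU0, fun U hU => ?_, h.integrable_starFlux h0,
    h.isGLB_asymVar (fun _ hU => hU) memU0, h.isGLB_asymVar memU0 fun _ hU => hU⟩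
  have hW := hU.isGibbsPotential hV
  have hWs := h.smooth_add hU
  obtain ⟨φ, hφ⟩ := h.exists_isPoissonSolution hU
  exact ⟨φ, _, hφ, fun ψ ψ' hψ =>
    ⟨hφ.ae_eq hW hWs hU.poincare hψ, hφ.deriv_ae_eq hW hWs hψ⟩⟩
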